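/- Let $K$ be a field, let $m,n\ge 0$, and let $\Delta$ be a simplicial complex on the vertex set $V\cup W$ with $V=\{v_1,\dots,v_m\}$ and $W=\{w_1,\dots,w_n\}$ disjoint (a family of subsets of $V\cup W$ closed under taking subsets). Let $R=K[\Delta]=K[X_1,\dots,X_m,Y_1,\dots,Y_n]/I_\Delta$ be its Stanley-Reisner ring, where the variables $X_i$ and $Y_j$ correspond to the vertices $v_i$ and $w_j$ and $I_\Delta$ is generated by the squarefree monomials of the non-faces of $\Delta$. Let $y_j\in R$ be the residue class of $Y_j$, put $P=(y_1,\dots,y_n)\subseteq R$, and let $i\ge 0$. Let $C^\bullet$ be the Čech complex of $R$ with respect to $y_1,\dots,y_n$, with $C^t=\bigoplus_{1\le j_1<\dots<j_t\le n}R_{y_{j_1}\cdots y_{j_t}}$ and its natural $\mathbb Z^m\times\mathbb Z^n$-grading. Then the local cohomology module $H^i_P(R)$ is isomorphic to $H^i(C^\bullet)$ as an $R$-module, and it is multigraded by means of such an isomorphism (any one may be used). For all $a\in\mathbb Z^m$ with $a_1,\dots,a_m\ge 0$ and all $b\in\mathbb Z^n$ with $b_1,\dots,b_n\le 0$ there is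 an isomorphism of $K$-vector spaces $$H^i_P(K[\Delta])_{(a,b)}\;\cong\;\widetilde H^{\,i-|F|-1}\bigl((\operatorname{lk}(F\cup G))_W;K\bigr),$$ where $F=\{w_j: b_j\ne 0\}$ and $G=\{v_k: a_k\neq 0\}$. Here $\operatorname{lk}(F\cup G)=\{T: T\cup F\cup G\in\Delta,\ T\cap(F\cup G)=\emptyset\}$ (which has no faces at all, and zero cohomology, if $F\cup G\notin\Delta$), the subscript $W$ denotes the subcomplex of all faces contained in $W$, and $\widetilde H^{q}(\Gamma;K)=H^q(\operatorname{Hom}_{\mathbb Z}(\widetilde{\mathcal C}(\Gamma),K))$, $q\in\mathbb Z$, is reduced simplicial cohomology, $\widetilde{\mathcal C}(\Gamma)$ being the augmented oriented chain complex. -/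

import Mathlib

universe u

noncomputable section

namespace MonomialLocalCohomology

/-! ### Simplicial complexes and reduced simplicial cohomology -/

/-- A simplicial complex on the vertex set `V`: a family of finite subsets of `V` that is closed
under taking subsets. The void family (no faces at all) and the family `{∅}` are both allowed, and
a point of `V` is not required to be a face. -/
abbrev SComplex (V : Type*) := LowerSet (Finset V)

/-- The link of `F` in `Δ`: all `G` with `F ∪ G ∈ Δ` and `F ∩ G = ∅`. It is void if `F ∉ Δ`. -/
def link {V : Type*} [DecidableEq V] (Δ : SComplex V) (F : Finset V) : SComplex V where
  carrier := {G | F ∪ G ∈ Δ ∧ F ∩ G = ∅}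
  lower' := by
    rintro G G' h ⟨h1, h2⟩
    refine ⟨Δ.lower (Finset.union_subset_union_right h) h1, ?_⟩
    exact Finset.subset_empty.mp (h2 ▸ Finset.inter_subset_inter_left h)

/-- The restriction `Δ_W` of a simplicial complex on the disjoint union of `V` and `W`: all faces
whose vertices belong to `W`, regarded as a simplicial complex on the vertex set `W`. -/
def restrict {V W : Type*} (Δ : SComplex (V ⊕ W)) : SComplex W where
  carrier := {T | T.map Function.Embedding.inr ∈ Δ}
  lower' := fun _ _ h hT => Δ.lower (Finset.map_subset_map.mpr h) hT

section Reduced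

variable {V : Type*} [LinearOrder V] (Δ : SComplex V)

/-- The faces of dimension `q`, that is, with `q + 1` vertices; `∅` has dimension `-1`. -/
def Face (q : ℤ) : Type _ := {F : Finset V // F ∈ Δ ∧ (F.card : ℤ) = q + 1}

/-- The group of the augmented oriented chain complex in degree `q`: free abelian on the faces of
dimension `q`, for all integers `q`. -/
abbrev Chain (q : ℤ) : Type _ := Face Δ q →₀ ℤ

/-- The facet of `F` obtained by deleting the vertex `v ∈ F`. -/
def Face.erase {p q : ℤ} (hpq : p = q + 1) (F : Face Δ p) (v : V) (hv : v ∈ F.1) : Face Δ q :=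
  ⟨F.1.erase v, Δ.lower (Finset.erase_subset v F.1) F.2.1, by
    have h1 := Finset.card_erase_add_one hv
    have h2 := F.2.2
    omega⟩

/-- The boundary map of the augmented oriented chain complex (from degree `p` to degree
`q = p - 1`): `∂[w₀, …, w_p] = ∑ₛ (-1)ˢ [w₀, …, ŵₛ, …, w_p]` for `w₀ < ⋯ < w_p`. -/
def boundary {p q : ℤ} (hpq : p = q + 1) : Chain Δ p →ₗ[ℤ] Chain Δ q :=
  Finsupp.lift (Chain Δ q) ℤ (Face Δ p) fun F =>
    ∑ v : {v // v ∈ F.1},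
      (-1 : ℤ) ^ (F.1.filter (· < v.1)).card •
        Finsupp.single (Face.erase Δ hpq F v.1 v.2) (1 : ℤ)

variable (K : Type*) [Field K]

/-- The coboundary map `Hom_ℤ(C̃_q, K) → Hom_ℤ(C̃_p, K)`, `p = q + 1`, dual to `boundary`. -/
def coboundary {p q : ℤ} (hpq : p = q + 1) : (Chain Δ q →ₗ[ℤ] K) →ₗ[K] (Chain Δ p →ₗ[ℤ] K) where
  toFun φ := φ ∘ₗ boundary Δ hpq
  map_add' _ _ := rfl
  map_smul' _ _ := rfl

/-- The reduced simplicial cohomology `H̃^q(Δ; K) = H^q(Hom_ℤ(C̃(Δ), K))`, for all integers `q`. -/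
abbrev ReducedCohomology (q : ℤ) : Type _ :=
  LinearMap.ker (coboundary Δ K (rfl : q + 1 = q + 1)) ⧸
    (LinearMap.range (coboundary Δ K (p := q) (q := q - 1) (by ring))).submoduleOf
      (LinearMap.ker (coboundary Δ K (rfl : q + 1 = q + 1)))

end Reduced

/-! ### Stanley-Reisner rings, with variables `x_1, …, x_m` and `y_1, …, y_n` -/

variable (K : Type u) [Field K] {m n : ℕ} (Δ : SComplex (Fin m ⊕ Fin n))

/-- The Stanley-Reisner ideal: generated by the squarefree monomials of the non-faces of `Δ`. -/
def srIdeal : Ideal (MvPolynomial (Fin m ⊕ Fin n) K) :=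
  Ideal.span {f | ∃ F : Finset (Fin m ⊕ Fin n), F ∉ Δ ∧ f = ∏ v ∈ F, MvPolynomial.X v}

/-- The Stanley-Reisner ring `K[Δ]`. -/
abbrev SRRing : Type u := MvPolynomial (Fin m ⊕ Fin n) K ⧸ srIdeal K Δ

/-- The residue class of the monomial with exponent vector `e`. -/
def srMonomial (e : Fin m ⊕ Fin n →₀ ℕ) : SRRing K Δ :=
  Ideal.Quotient.mk (srIdeal K Δ) (MvPolynomial.monomial e 1)

/-- The residue class `y_j` of the variable belonging to the vertex `w_j`. -/
def y (j : Fin n) : SRRing K Δ := Ideal.Quotient.mk (srIdeal K Δ) (MvPolynomial.X (Sum.inr j))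

/-- The ideal `P = (y_1, …, y_n)` of `K[Δ]`. -/
def idealP : Ideal (SRRing K Δ) := Ideal.span (Set.range (y K Δ))

/-- The component of `K[Δ]` of multidegree `c ∈ ℤ^m × ℤ^n`: the image of the corresponding
component of the polynomial ring. -/
def srComponent (c : Fin m ⊕ Fin n → ℤ) : Submodule K (SRRing K Δ) :=
  Submodule.span K {r | ∃ e : Fin m ⊕ Fin n →₀ ℕ, (∀ v, (e v : ℤ) = c v) ∧ r = srMonomial K Δ e}

/-! ### The Čech complex of `K[Δ]` with respect to `y_1, …, y_n` and its multigrading -/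

/-- `y_T = ∏_{j ∈ T} y_j`. -/
def yProd (T : Finset (Fin n)) : SRRing K Δ := ∏ j ∈ T, y K Δ j

/-- The localization `K[Δ]_{y_T}`. -/
abbrev CechLoc (T : Finset (Fin n)) : Type u := Localization.Away (yProd K Δ T)

/-- For `T ⊆ T'`, `y_T` is a unit in the localization at `y_{T'}`. -/
theorem isUnit_yProd {T T' : Finset (Fin n)} (h : T ⊆ T') :
    IsUnit (algebraMap (SRRing K Δ) (CechLoc K Δ T') (yProd K Δ T)) := by
  refine isUnit_of_dvd_unit (map_dvd _ ?_)
    (IsLocalization.Away.algebraMap_isUnit (S := CechLoc K Δ T') (yProd K Δ T'))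
  exact Finset.prod_dvd_prod_of_subset T T' _ h

/-- The natural map `K[Δ]_{y_T} → K[Δ]_{y_{T'}}` for `T ⊆ T'`. -/
def cechNat {T T' : Finset (Fin n)} (h : T ⊆ T') : CechLoc K Δ T →ₐ[SRRing K Δ] CechLoc K Δ T' :=
  IsLocalization.liftAlgHom (M := Submonoid.powers (yProd K Δ T))
    (f := Algebra.ofId (SRRing K Δ) (CechLoc K Δ T')) (by
      rintro ⟨_, k, rfl⟩
      change IsUnit (algebraMap (SRRing K Δ) (CechLoc K Δ T') (yProd K Δ T ^ k))
      rw [map_pow]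
      exact (isUnit_yProd K Δ h).pow k)

/-- The module `C^t = ⨁ K[Δ]_{y_{j_1} ⋯ y_{j_t}}` over `1 ≤ j_1 < ⋯ < j_t ≤ n`. -/
abbrev CechCochain (t : ℕ) : Type u := (T : {T : Finset (Fin n) // T.card = t}) → CechLoc K Δ T.1

/-- The Čech differential `C^t → C^{t+1}`: its component from `T' \ {j}` to `T'` is `(-1)^{s-1}`
times the natural map, where `j` is the `s`-th smallest element of `T'`. -/
def cechD (t : ℕ) : CechCochain K Δ t →ₗ[SRRing K Δ] CechCochain K Δ (t + 1) :=
  LinearMap.pi fun T' => ∑ j : {j // j ∈ T'.1},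
    (-1 : ℤ) ^ (T'.1.filter (· < j.1)).card •
      ((cechNat K Δ (Finset.erase_subset j.1 T'.1)).toLinearMap ∘ₗ
        LinearMap.proj (R := SRRing K Δ)
          (φ := fun T : {T : Finset (Fin n) // T.card = t} => CechLoc K Δ T.1)
          ⟨T'.1.erase j.1, by rw [Finset.card_erase_of_mem j.2, T'.2, Nat.add_sub_cancel]⟩)

/-- The coboundaries in `C^i`. -/
def cechBoundaries : (i : ℕ) → Submodule (SRRing K Δ) (CechCochain K Δ i)
  | 0 => ⊥
  | i + 1 => LinearMap.range (cechD K Δ i)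

/-- The `i`-th cohomology module of the Čech complex. -/
abbrev CechCohomology (i : ℕ) : Type u :=
  LinearMap.ker (cechD K Δ i) ⧸ (cechBoundaries K Δ i).submoduleOf (LinearMap.ker (cechD K Δ i))

/-- The multidegree of `y_T`. -/
def yDegree (T : Finset (Fin n)) : Fin m ⊕ Fin n → ℤ :=
  Sum.elim (fun _ => 0) (fun j => if j ∈ T then 1 else 0)

/-- The component of `K[Δ]_{y_T}` of multidegree `c`: all fractions `r / y_T ^ l` with `r`
homogeneous and `deg r - l * deg y_T = c`. -/
def locComponent (T : Finset (Fin n)) (c : Fin m ⊕ Fin n → ℤ) : Submodule K (CechLoc K Δ T) :=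
  Submodule.span K {z | ∃ (l : ℕ) (d : Fin m ⊕ Fin n → ℤ) (r : SRRing K Δ),
    r ∈ srComponent K Δ d ∧ d - l • yDegree T = c ∧
      z = Localization.mk r
        (⟨yProd K Δ T ^ l, ⟨l, rfl⟩⟩ : Submonoid.powers (yProd K Δ T))}

/-- The component of `C^t` of multidegree `c`. -/
def cechComponent (t : ℕ) (c : Fin m ⊕ Fin n → ℤ) : Submodule K (CechCochain K Δ t) :=
  Submodule.pi Set.univ fun T => locComponent K Δ T.1 c

/-- The component of the Čech cohomology of multidegree `c`: the classes of the cocycles that are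
homogeneous of multidegree `c`. -/
def cechCohomologyComponent (i : ℕ) (c : Fin m ⊕ Fin n → ℤ) : Submodule K (CechCohomology K Δ i) :=
  ((cechComponent K Δ i c).comap ((LinearMap.ker (cechD K Δ i)).subtype.restrictScalars K)).map
    (((cechBoundaries K Δ i).submoduleOf (LinearMap.ker (cechD K Δ i))).mkQ.restrictScalars K)

/-! ### Local cohomology of `K[Δ]` with respect to `P` -/

/-- The local cohomology module `H^i_P(K[Δ])`. -/
abbrev LC (i : ℕ) : ModuleCat.{u} (SRRing K Δ) :=
  (localCohomology (idealP K Δ) i).obj (ModuleCat.of (SRRing K Δ) (SRRing K Δ))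

/-- `H^i_P(K[Δ])` as a vector space over `K ⊆ K[Δ]`. -/
instance lcModule (i : ℕ) : Module K (LC K Δ i) :=
  Module.compHom (LC K Δ i) (algebraMap K (SRRing K Δ))

instance lcIsScalarTower (i : ℕ) : IsScalarTower K (SRRing K Δ) (LC K Δ i) :=
  ⟨fun k r x => by
    have h : k • r = algebraMap K (SRRing K Δ) k * r := Algebra.smul_def k r
    exact (congrArg (fun z : SRRing K Δ => z • x) h).trans
      (mul_smul (algebraMap K (SRRing K Δ) k) r x)⟩

/-- The component `H^i_P(K[Δ])_c` of multidegree `c ∈ ℤ^m × ℤ^n`, for the multigrading that the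
Čech complex induces through an isomorphism `e` of `H^i_P(K[Δ])` with the Čech cohomology. -/
def lcComponent (i : ℕ) (e : LC K Δ i ≃ₗ[SRRing K Δ] CechCohomology K Δ i)
    (c : Fin m ⊕ Fin n → ℤ) : Submodule K (LC K Δ i) :=
  (cechCohomologyComponent K Δ i c).comap (e.toLinearMap.restrictScalars K)

/-- The support of an integer vector. -/
def supp {k : ℕ} (a : Fin k → ℤ) : Finset (Fin k) := Finset.univ.filter fun i => a i ≠ 0

end MonomialLocalCohomology

end

/-!
The theorem has two halves.

*Local cohomology is Čech cohomology.* Local cohomology is the colimit of the functors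
`Ext^i(R ⧸ P ^ t, -)`, and `Ext` is computed here by projective resolutions of the first argument.
Both `H^i_P` and the cohomology of the Čech complex `C^•(M)` turn a short exact sequence
`0 → M → E → N → 0` of modules into a long exact sequence, and both vanish in positive degrees if
`E` is injective. Hence both satisfy `H^{i+2}(M) ≅ H^{i+1}(N)`, and `H^1(M)` is in both cases the
cokernel of `H^0(E) → H^0(N)`, where `H^0` consists of the elements killed by a power of `P`.
Induction on `i` along embeddings into injective modules gives
`nonempty_localCohomology_equiv_cechComplex_homology`. The vanishing for local cohomology is the
exactness of `Hom(-, E)`. The vanishing for the Čech complex rests on `exists_pow_add_smul_eq`: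
as `R` is Noetherian, the annihilators of `y ^ N • e` stabilize, so that `y ^ N • e` is divisible
by `y ^ (N + k)` for large `N` if `e` lies in an injective module. This makes the map
`E_{y_{T'}} → E_{y_T}`, and its restriction to the elements that die after inverting any of some
further variables, surjective (`exists_cechModNat_eq`), and a cube of modules with this property
has an exact total complex in positive degrees (`exists_cubeD_eq`).

*The homogeneous strands.* Let `a ≥ 0` and `b ≤ 0`, with supports `G` and `F`. The component of
multidegree `(a, b)` of `K[Δ]_{y_T}` is spanned by the Laurent monomial of that multidegree if
`F ⊆ T` and `G ∪ T ∈ Δ`, and it vanishes otherwise (`exists_strandMonomial`,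
`locComponent_eq_bot`). The sets `T` of the first kind are the sets `F ∪ S` for the faces `S` of
`(lk (F ∪ G))_W`, so that extracting the coefficient of multidegree `(a, b)` is a bijection from
the homogeneous Čech cochains to the simplicial cochains of this complex, with a shift of `|F| + 1`
in the degree. With the sign `shuffleSign` it commutes with the differentials (`strandMap_cechD`),
and the two cohomology spaces are quotients of one space of homogeneous cocycles by the same
subspace.
-/

noncomputable section

namespace CategoryTheory

open Limits

universe v

/-! ### The long exact sequence of left derived functors in the functor -/

section LeftDerivedSequence

variable {C : Type u} [Category.{v} C] [Abelian C] [HasProjectiveResolutions C]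
  {D : Type*} [Category* D] [Abelian D]
  {F G H : C ⥤ D} [F.Additive] [G.Additive] [H.Additive] (α : F ⟶ G) (β : G ⟶ H)
  (w : α ≫ β = 0)

/-- The sequence of chain complexes obtained by evaluating `F ⟶ G ⟶ H` on a chain complex. -/
@[simps]
def mapComplexSequence (P : ChainComplex C ℕ) : ShortComplex (ChainComplex D ℕ) where
  X₁ := (F.mapHomologicalComplex _).obj P
  X₂ := (G.mapHomologicalComplex _).obj P
  X₃ := (H.mapHomologicalComplex _).obj P
  f := (NatTrans.mapHomologicalComplex α _).app P
  g := (NatTrans.mapHomologicalComplex β _).app P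
  zero := by
    ext i
    exact congr_app w (P.X i)

/-- Functoriality of `mapComplexSequence` in the chain complex. -/
@[simps]
def mapComplexSequenceMap {P Q : ChainComplex C ℕ} (φ : P ⟶ Q) :
    mapComplexSequence α β w P ⟶ mapComplexSequence α β w Q where
  τ₁ := (F.mapHomologicalComplex _).map φ
  τ₂ := (G.mapHomologicalComplex _).map φ
  τ₃ := (H.mapHomologicalComplex _).map φ
  comm₁₂ := ((NatTrans.mapHomologicalComplex α _).naturality φ)
  comm₂₃ := ((NatTrans.mapHomologicalComplex β _).naturality φ)

variable (hS : ∀ X : C, Projective X →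
  (ShortComplex.mk (α.app X) (β.app X) (congr_app w X)).ShortExact)

omit [HasProjectiveResolutions C] in
variable {α β w} in
include hS in
/-- The sequence of functors is only required to be exact on projective objects: this is the case
for `Hom(-, N) ⟶ Hom(-, E) ⟶ Hom(-, M)`, which is not exact on all objects. -/
theorem mapComplexSequence_shortExact {X : C} (P : ProjectiveResolution X) :
    (mapComplexSequence α β w P.complex).ShortExact :=
  HomologicalComplex.shortExact_of_degreewise_shortExact _ fun i =>
    hS (P.complex.X i) (P.projective i)

variable {α β w} in
/-- The connecting morphism in homology of `mapComplexSequence`. -/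
def complexδ {P : ChainComplex C ℕ} (hP : (mapComplexSequence α β w P).ShortExact) (n : ℕ) :
    (HomologicalComplex.homologyFunctor D _ (n + 1)).obj ((H.mapHomologicalComplex _).obj P) ⟶
      (HomologicalComplex.homologyFunctor D _ n).obj ((F.mapHomologicalComplex _).obj P) :=
  hP.δ (n + 1) n (ComplexShape.down_mk _ _ rfl)

omit [HasProjectiveResolutions C] in
theorem complexδ_naturality {P Q : ChainComplex C ℕ}
    (hP : (mapComplexSequence α β w P).ShortExact) (hQ : (mapComplexSequence α β w Q).ShortExact)
    (φ : P ⟶ Q) (n : ℕ) :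
    complexδ hP n ≫ (F.mapHomologicalComplex _ ⋙ HomologicalComplex.homologyFunctor _ _ n).map φ =
      (H.mapHomologicalComplex _ ⋙ HomologicalComplex.homologyFunctor _ _ (n + 1)).map φ ≫
        complexδ hQ n :=
  HomologicalComplex.HomologySequence.δ_naturality
      (mapComplexSequenceMap α β w φ) hP hQ (n + 1) n (ComplexShape.down_mk _ _ rfl)

omit [HasProjectiveResolutions C] in
theorem complexδ_comp {P : ChainComplex C ℕ}
    (hP : (mapComplexSequence α β w P).ShortExact) (n : ℕ) :
    complexδ hP n ≫ (HomologicalComplex.homologyFunctor D (ComplexShape.down ℕ) n).map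
        ((NatTrans.mapHomologicalComplex α _).app P) = 0 :=
  hP.δ_comp (n + 1) n (ComplexShape.down_mk _ _ rfl)

/-- The connecting morphism between left derived functors attached to a sequence of additive
functors that is short exact on projective objects. -/
def leftDerivedδ (n : ℕ) : H.leftDerived (n + 1) ⟶ F.leftDerived n where
  app X := ((projectiveResolution X).isoLeftDerivedObj H (n + 1)).hom ≫
    complexδ (mapComplexSequence_shortExact (w := w) hS (projectiveResolution X)) n ≫
      ((projectiveResolution X).isoLeftDerivedObj F n).inv
  naturality X Y f := by
    let P := projectiveResolution X
    let Q := projectiveResolution Y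
    have comm : (ProjectiveResolution.lift f P Q).f 0 ≫ Q.π.f 0 = P.π.f 0 ≫ f :=
      ProjectiveResolution.lift_commutes_zero f P Q
    rw [ProjectiveResolution.isoLeftDerivedObj_hom_naturality_assoc f P Q _ comm H (n + 1),
      Category.assoc, Category.assoc,
      ProjectiveResolution.isoLeftDerivedObj_inv_naturality f P Q _ comm F n,
      ← reassoc_of% (complexδ_naturality α β w (mapComplexSequence_shortExact (w := w) hS P)
        (mapComplexSequence_shortExact (w := w) hS Q) (ProjectiveResolution.lift f P Q) n)]
    rfl

variable {α β w hS} in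
theorem isIso_leftDerivedδ_app {n : ℕ} {X : C} (h1 : IsZero ((G.leftDerived (n + 1)).obj X))
    (h0 : IsZero ((G.leftDerived n).obj X)) : IsIso ((leftDerivedδ α β w hS n).app X) := by
  have e (k) := ((projectiveResolution X).isoLeftDerivedObj G k)
  have : IsIso (complexδ (mapComplexSequence_shortExact (w := w) hS (projectiveResolution X)) n) :=
    (mapComplexSequence_shortExact (w := w) hS (projectiveResolution X)).isIso_δ (n + 1) n _
      (h1.of_iso (e (n + 1)).symm) (h0.of_iso (e n).symm)
  dsimp only [leftDerivedδ]
  infer_instance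

variable {α β w hS} in
theorem mono_leftDerivedδ_app {n : ℕ} {X : C} (h1 : IsZero ((G.leftDerived (n + 1)).obj X)) :
    Mono ((leftDerivedδ α β w hS n).app X) := by
  have e (k) := ((projectiveResolution X).isoLeftDerivedObj G k)
  have : Mono (complexδ (mapComplexSequence_shortExact (w := w) hS (projectiveResolution X)) n) :=
    (mapComplexSequence_shortExact (w := w) hS (projectiveResolution X)).mono_δ (n + 1) n _
      (h1.of_iso (e (n + 1)).symm)
  dsimp only [leftDerivedδ]
  infer_instance

theorem leftDerivedδ_comp (n : ℕ) :
    leftDerivedδ α β w hS n ≫ NatTrans.leftDerived α n = 0 := by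
  ext X
  rw [NatTrans.comp_app, ProjectiveResolution.leftDerived_app_eq α (projectiveResolution X) n]
  dsimp only [leftDerivedδ]
  rw [Category.assoc, Category.assoc, Iso.inv_hom_id_assoc, reassoc_of% (complexδ_comp α β w
    (mapComplexSequence_shortExact (w := w) hS (projectiveResolution X)) n)]
  simp

/-- The part of the long exact sequence around `F.leftDerived n`. -/
theorem leftDerivedδ_exact (n : ℕ) (X : C) :
    (ShortComplex.mk ((leftDerivedδ α β w hS n).app X) ((NatTrans.leftDerived α n).app X)
      (congr_app (leftDerivedδ_comp α β w hS n) X)).Exact := by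
  have h : (ShortComplex.mk _ _ (complexδ_comp α β w
      (mapComplexSequence_shortExact (w := w) hS (projectiveResolution X)) n)).Exact :=
    (mapComplexSequence_shortExact (w := w) hS (projectiveResolution X)).homology_exact₁
      (n + 1) n (ComplexShape.down_mk _ _ rfl)
  refine (ShortComplex.exact_iff_of_iso (ShortComplex.isoMk
    ((projectiveResolution X).isoLeftDerivedObj H (n + 1))
    ((projectiveResolution X).isoLeftDerivedObj F n)
    ((projectiveResolution X).isoLeftDerivedObj G n) ?_ ?_)).2 h
  · dsimp only [leftDerivedδ]
    rw [Category.assoc, Category.assoc, Iso.inv_hom_id, Category.comp_id]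
  · dsimp only
    rw [ProjectiveResolution.leftDerived_app_eq α (projectiveResolution X) n]
    rw [Category.assoc, Category.assoc, Iso.inv_hom_id, Category.comp_id]

/-- The comparison of a functor with its zeroth left derived functor is natural in the functor. -/
theorem leftDerived_zero_comp_fromLeftDerivedZero :
    NatTrans.leftDerived α 0 ≫ G.fromLeftDerivedZero = F.fromLeftDerivedZero ≫ α := by
  ext X
  let P := projectiveResolution X
  rw [NatTrans.comp_app, NatTrans.comp_app, ProjectiveResolution.leftDerived_app_eq α P,
    P.fromLeftDerivedZero_eq, P.fromLeftDerivedZero_eq]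
  simp only [Category.assoc, Iso.inv_hom_id_assoc]
  congr 1
  have h : HomologicalComplex.opcyclesMap
      ((NatTrans.mapHomologicalComplex α (ComplexShape.down ℕ)).app P.complex) 0 ≫
        P.fromLeftDerivedZero' G = P.fromLeftDerivedZero' F ≫ α.app X := by
    rw [← cancel_epi (HomologicalComplex.pOpcycles _ _),
      HomologicalComplex.p_opcyclesMap_assoc,
      ProjectiveResolution.pOpcycles_comp_fromLeftDerivedZero'_assoc,
      ProjectiveResolution.pOpcycles_comp_fromLeftDerivedZero']
    exact (α.naturality (P.π.f 0)).symm
  have h' := HomologicalComplex.homologyι_naturality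
    ((NatTrans.mapHomologicalComplex α (ComplexShape.down ℕ)).app P.complex) 0
  refine Eq.trans ?_ (((reassoc_of% h') (P.fromLeftDerivedZero' G)).trans ?_)
  · rfl
  · rw [h]
    exact (Category.assoc _ _ _).symm

end LeftDerivedSequence

end CategoryTheory

namespace MonomialLocalCohomology

section ExtColimits

open CategoryTheory Limits Opposite

/-! ### Exactness of filtered colimits of modules -/

section Colimits

/-- Mathlib has this for index categories in the universe of the modules; local cohomology is a
colimit over a category in `Type`. -/
instance {R : Type u} [CommRing R] {I : Type} [SmallCategory I] [IsFiltered I] :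
    PreservesColimitsOfShape I (forget (ModuleCat.{u} R)) :=
  have : PreservesFilteredColimitsOfSize.{0, 0} (forget (ModuleCat.{u} R)) :=
    preservesFilteredColimitsOfSize_shrink.{0, u, 0, u} _
  this.preserves_filtered_colimits I

variable {R : Type u} [CommRing R] {I : Type} [SmallCategory I] [IsFiltered I]
  {A B C : I ⥤ ModuleCat.{u} R} (f : A ⟶ B) (g : B ⟶ C)

theorem colimMap_surjective (hg : ∀ i, Function.Surjective (g.app i).hom) :
    Function.Surjective (colimMap g).hom := by
  intro z
  obtain ⟨i, z, rfl⟩ := Concrete.colimit_exists_rep C z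
  obtain ⟨y, rfl⟩ := hg i z
  exact ⟨colimit.ι B i y, ConcreteCategory.congr_hom (ι_colimMap g i) y⟩

theorem colimMap_exact (h : ∀ i, Function.Exact (f.app i).hom (g.app i).hom) :
    Function.Exact (colimMap f).hom (colimMap g).hom := by
  intro x
  constructor
  · intro hx
    obtain ⟨i, y, rfl⟩ := Concrete.colimit_exists_rep B x
    rw [← ConcreteCategory.comp_apply, ι_colimMap, ConcreteCategory.comp_apply] at hx
    obtain ⟨j, φ, hj⟩ := Concrete.colimit_rep_eq_zero R C i _ hx
    have hj' : (g.app j).hom ((B.map φ).hom y) = 0 := by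
      rw [← hj]
      exact ConcreteCategory.congr_hom (g.naturality φ) y
    obtain ⟨t, ht⟩ := (h j _).1 hj'
    refine ⟨colimit.ι A j t, ?_⟩
    rw [← ConcreteCategory.comp_apply, ι_colimMap, ConcreteCategory.comp_apply]
    refine (congrArg (colimit.ι B j) ht).trans ?_
    exact ConcreteCategory.congr_hom (colimit.w B φ) y
  · rintro ⟨x, rfl⟩
    obtain ⟨i, y, rfl⟩ := Concrete.colimit_exists_rep A x
    refine (congrArg (colimMap g) (ConcreteCategory.congr_hom (ι_colimMap f i) y)).trans ?_
    refine (ConcreteCategory.congr_hom (ι_colimMap g i) _).trans ?_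
    exact (congrArg (colimit.ι C i) ((h i).apply_apply_eq_zero y)).trans (map_zero _)

end Colimits

/-! ### `Hom` of modules and its derived functors in both arguments -/

section Ext

variable {R : Type u} [CommRing R]

/-- The contravariant functor `Hom(-, M)` as a covariant functor to the opposite category. -/
abbrev homOp (M : ModuleCat.{u} R) : ModuleCat.{u} R ⥤ (ModuleCat.{u} R)ᵒᵖ :=
  ((linearYoneda R (ModuleCat.{u} R)).obj M).rightOp

/-- `homOp` is contravariant in the module. -/
abbrev homOpMap {M N : ModuleCat.{u} R} (f : M ⟶ N) : homOp N ⟶ homOp M :=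
  NatTrans.rightOp ((linearYoneda R (ModuleCat.{u} R)).map f)

/-- Exactness of `Hom(-, E)` for injective `E`. -/
theorem homOp_map_exact (E : ModuleCat.{u} R) [Injective E] (S : ShortComplex (ModuleCat.{u} R))
    (hS : S.Exact) : (S.map (homOp E)).Exact := by
  rw [← ShortComplex.exact_unop_iff, ShortComplex.moduleCat_exact_iff]
  intro x hx
  refine ⟨hS.descToInjective x ?_, ?_⟩
  · exact hx
  · exact hS.comp_descToInjective x _

/-- `Ext^{n+1}(X, E)` vanishes for injective `E`. -/
theorem isZero_leftDerived_homOp (E : ModuleCat.{u} R) [Injective E] (n : ℕ)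
    (X : ModuleCat.{u} R) : IsZero (((homOp E).leftDerived (n + 1)).obj X) := by
  refine IsZero.of_iso ?_ ((projectiveResolution X).isoLeftDerivedObj (homOp E) (n + 1))
  refine (HomologicalComplex.exactAt_iff_isZero_homology _ _).1 ?_
  exact homOp_map_exact E _ ((projectiveResolution X).complex_exactAt_succ n)

/-- Left exactness of `Hom(-, M)`, read in the opposite category. -/
theorem homOp_map_exact_of_epi (M : ModuleCat.{u} R) (S : ShortComplex (ModuleCat.{u} R))
    (hS : S.Exact) [Epi S.g] : (S.map (homOp M)).Exact ∧ Epi (S.map (homOp M)).g := by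
  constructor
  · rw [← ShortComplex.exact_unop_iff, ShortComplex.moduleCat_exact_iff]
    intro x hx
    exact ⟨hS.desc x hx, hS.g_desc x hx⟩
  · have : Mono ((homOp M).map S.g).unop := by
      rw [ModuleCat.mono_iff_injective]
      intro a b h
      exact (cancel_epi S.g).1 h
    exact unop_mono_iff _ |>.1 this

instance (M : ModuleCat.{u} R) : PreservesFiniteColimits (homOp M) := by
  exact (((homOp M).preservesFiniteColimits_tfae).out 0 3).1
    fun (S : ShortComplex (ModuleCat.{u} R)) (hS : S.ShortExact) =>
      have := hS.epi_g
      homOp_map_exact_of_epi M S hS.exact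

variable {S : ShortComplex (ModuleCat.{u} R)}

theorem comp_comp_eq_zero (S : ShortComplex (ModuleCat.{u} R)) {X : ModuleCat.{u} R}
    (a : X ⟶ S.X₁) : (a ≫ S.f) ≫ S.g = 0 := by
  rw [Category.assoc, S.zero, comp_zero]

theorem homOpMap_comp (S : ShortComplex (ModuleCat.{u} R)) : homOpMap S.g ≫ homOpMap S.f = 0 := by
  ext X
  apply Quiver.Hom.unop_inj
  ext a : 2
  exact comp_comp_eq_zero S a

/-- `Hom(X, -)` is exact for projective `X`. -/
theorem homOpMap_shortExact (hS : S.ShortExact) (X : ModuleCat.{u} R) [Projective X] :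
    (ShortComplex.mk ((homOpMap S.g).app X) ((homOpMap S.f).app X)
      (congr_app (homOpMap_comp S) X)).ShortExact := by
  have := hS.mono_f
  have := hS.epi_g
  rw [ShortComplex.shortExact_iff_unop]
  refine ModuleCat.shortComplex_shortExact _ ?_ ?_ ?_
  · intro x
    constructor
    · intro hx
      exact ⟨hS.exact.lift x hx, hS.exact.lift_f x hx⟩
    · rintro ⟨a, rfl⟩
      exact comp_comp_eq_zero S a
  · intro a b h
    exact (cancel_mono S.f).1 h
  · intro x
    exact ⟨Projective.factorThru x S.g, Projective.factorThru_comp x S.g⟩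

end Ext

/-! ### Local cohomology: dimension shifting along an injective module -/

section LocalCohomology

/-- An isomorphism of functors to an opposite category induces one in the other direction between
the contravariant functors. -/
def leftOpIso {C D : Type*} [Category* C] [Category* D] {F G : C ⥤ Dᵒᵖ} (e : F ≅ G) :
    G.leftOp ≅ F.leftOp where
  hom := NatTrans.leftOp e.hom
  inv := NatTrans.leftOp e.inv
  hom_inv_id := by rw [← NatTrans.leftOp_comp, e.inv_hom_id, NatTrans.leftOp_id]
  inv_hom_id := by rw [← NatTrans.leftOp_comp, e.hom_inv_id, NatTrans.leftOp_id]

variable {R : Type u} [CommRing R] (J : Ideal R)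

/-- The directed system of the modules `R ⧸ J ^ t`, in the opposite category. -/
abbrev quotPowers : (ℕᵒᵖ)ᵒᵖ ⥤ (ModuleCat.{u} R)ᵒᵖ :=
  (localCohomology.ringModIdeals (localCohomology.idealPowersDiagram J)).op

/-- The directed system `Ext^i(R ⧸ J ^ t, M)`. -/
abbrev extPowers (i : ℕ) (M : ModuleCat.{u} R) : (ℕᵒᵖ)ᵒᵖ ⥤ ModuleCat.{u} R :=
  quotPowers J ⋙ ((homOp M).leftDerived i).leftOp

/-- The directed system `Hom(R ⧸ J ^ t, M)`. -/
abbrev homPowers (M : ModuleCat.{u} R) : (ℕᵒᵖ)ᵒᵖ ⥤ ModuleCat.{u} R :=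
  quotPowers J ⋙ (linearYoneda R (ModuleCat.{u} R)).obj M

/-- Local cohomology as a colimit of modules, rather than the value of a colimit of functors. -/
def localCohomologyObjIso (i : ℕ) (M : ModuleCat.{u} R) :
    (localCohomology J i).obj M ≅ colimit (extPowers J i M) :=
  colimitObjIsoColimitCompEvaluation
    (localCohomology.diagram (localCohomology.idealPowersDiagram J) i) M

variable {S : ShortComplex (ModuleCat.{u} R)}

/-- Dimension shifting in degrees at least two. -/
theorem nonempty_localCohomology_succ_iso (hS : S.ShortExact) [Injective S.X₂] (i : ℕ) :
    Nonempty ((localCohomology J (i + 2)).obj S.X₁ ≅ (localCohomology J (i + 1)).obj S.X₃) := by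
  let δ := leftDerivedδ (homOpMap S.g) (homOpMap S.f) (homOpMap_comp S)
    (fun X _ => homOpMap_shortExact hS X) (i + 1)
  have (X : ModuleCat.{u} R) : IsIso (δ.app X) :=
    isIso_leftDerivedδ_app (isZero_leftDerived_homOp S.X₂ (i + 1) X)
      (isZero_leftDerived_homOp S.X₂ i X)
  have : IsIso δ := NatIso.isIso_of_isIso_app δ
  have e : extPowers J (i + 1) S.X₃ ≅ extPowers J (i + 2) S.X₁ :=
    Functor.isoWhiskerLeft (quotPowers J) (leftOpIso (asIso δ))
  exact ⟨localCohomologyObjIso J _ _ ≪≫ HasColimit.isoOfNatIso e.symm ≪≫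
    (localCohomologyObjIso J _ _).symm⟩

/-- The zeroth directed system of `Ext` modules is the system of `Hom` modules. -/
def extPowersZeroIso (M : ModuleCat.{u} R) : homPowers J M ≅ extPowers J 0 M :=
  Functor.isoWhiskerLeft (quotPowers J)
    (leftOpIso (homOp M).leftDerivedZeroIsoSelf)

/-- The submodule of the elements killed by a power of `J`. -/
def torsionPowers (M : Type u) [AddCommGroup M] [Module R M] : Submodule R M where
  carrier := {x | ∃ t : ℕ, ∀ r ∈ J ^ t, r • x = 0}
  zero_mem' := ⟨0, fun r _ => smul_zero r⟩
  add_mem' := by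
    rintro x y ⟨s, hs⟩ ⟨t, ht⟩
    refine ⟨s + t, fun r hr => ?_⟩
    rw [smul_add, hs r (Ideal.pow_le_pow_right (Nat.le_add_right s t) hr),
      ht r (Ideal.pow_le_pow_right (Nat.le_add_left t s) hr), add_zero]
  smul_mem' := by
    rintro c x ⟨t, ht⟩
    exact ⟨t, fun r hr => by rw [smul_comm, ht r hr, smul_zero]⟩

/-- A linear map restricts to the submodules of elements killed by a power of `J`. -/
def torsionPowersMap {M N : Type u} [AddCommGroup M] [Module R M] [AddCommGroup N] [Module R N]
    (f : M →ₗ[R] N) : torsionPowers J M →ₗ[R] torsionPowers J N :=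
  f.restrict (by
    rintro x ⟨t, ht⟩
    exact ⟨t, fun r hr => by rw [← map_smul, ht r hr, map_zero]⟩)

/-- Evaluation at `1` embeds `Hom(R ⧸ J ^ t, M)` into the elements killed by a power of `J`. -/
def homPowersCocone (M : ModuleCat.{u} R) : Cocone (homPowers J M) where
  pt := ModuleCat.of R (torsionPowers J M)
  ι :=
    { app t := ModuleCat.ofHom
        { toFun f := ⟨f.hom (Ideal.Quotient.mk _ 1), t.unop.unop, fun r hr => by
            refine (map_smul f.hom r _).symm.trans ((congrArg _ ?_).trans (map_zero f.hom))
            refine Eq.trans ?_ (Ideal.Quotient.eq_zero_iff_mem.2 hr)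
            exact congrArg (Ideal.Quotient.mk _) (mul_one r)⟩
          map_add' _ _ := rfl
          map_smul' _ _ := rfl }
      naturality s t φ := by
        ext f
        rfl }

theorem homPowersCocone_desc_bijective (M : ModuleCat.{u} R) :
    Function.Bijective (colimit.desc _ (homPowersCocone J M)).hom := by
  have hdesc (t : (ℕᵒᵖ)ᵒᵖ) (f : (homPowers J M).obj t) :
      (colimit.desc _ (homPowersCocone J M)).hom (colimit.ι (homPowers J M) t f) =
        ((homPowersCocone J M).ι.app t).hom f :=
    ConcreteCategory.congr_hom (colimit.ι_desc (homPowersCocone J M) t) f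
  constructor
  · rw [injective_iff_map_eq_zero]
    intro x hx
    obtain ⟨t, f, rfl⟩ := Concrete.colimit_exists_rep (homPowers J M) x
    have h1 : (f : ModuleCat.of R (R ⧸ J ^ t.unop.unop) ⟶ M).hom (Ideal.Quotient.mk _ 1) = 0 :=
      congrArg Subtype.val ((hdesc t f).symm.trans hx)
    have hf : f = 0 := by
      refine ModuleCat.hom_ext (LinearMap.ext fun a => ?_)
      obtain ⟨r, rfl⟩ := Ideal.Quotient.mk_surjective a
      have h2 : Ideal.Quotient.mk (J ^ t.unop.unop) r = r • Ideal.Quotient.mk _ 1 :=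
        congrArg (Ideal.Quotient.mk _) (mul_one r).symm
      refine (congrArg _ h2).trans ((map_smul _ _ _).trans ?_)
      exact (congrArg (r • ·) h1).trans (smul_zero r)
    rw [hf]
    exact map_zero _
  · rintro ⟨x, t, ht⟩
    let f : ModuleCat.of R (R ⧸ J ^ t) ⟶ M :=
      ModuleCat.ofHom ((J ^ t).liftQ (LinearMap.toSpanSingleton R M x) fun r hr => ht r hr)
    refine ⟨colimit.ι (homPowers J M) (op (op t)) f, (hdesc (op (op t)) f).trans ?_⟩
    exact Subtype.ext (one_smul R x)

/-- The colimit of the modules `Hom(R ⧸ J ^ t, M)` consists of the elements of `M` that are killed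
by a power of `J`. -/
def colimitHomPowersEquiv (M : ModuleCat.{u} R) :
    (colimit (homPowers J M) : ModuleCat.{u} R) ≃ₗ[R] torsionPowers J M :=
  LinearEquiv.ofBijective (colimit.desc _ (homPowersCocone J M)).hom
    (homPowersCocone_desc_bijective J M)

theorem colimitHomPowersEquiv_naturality {M N : ModuleCat.{u} R} (f : M ⟶ N) :
    (colimitHomPowersEquiv J N).toLinearMap ∘ₗ (colimMap (Functor.whiskerLeft (quotPowers J)
      ((linearYoneda R (ModuleCat.{u} R)).map f))).hom =
    torsionPowersMap J f.hom ∘ₗ (colimitHomPowersEquiv J M).toLinearMap := by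
  have h : colimMap (Functor.whiskerLeft (quotPowers J)
      ((linearYoneda R (ModuleCat.{u} R)).map f)) ≫ colimit.desc _ (homPowersCocone J N) =
      colimit.desc _ (homPowersCocone J M) ≫ ModuleCat.ofHom (torsionPowersMap J f.hom) := by
    refine colimit.hom_ext fun t => ?_
    rw [ι_colimMap_assoc, colimit.ι_desc]
    refine Eq.trans ?_ ((reassoc_of% (colimit.ι_desc (homPowersCocone J M) t)) _).symm
    rfl
  exact congrArg ModuleCat.Hom.hom h

theorem nonempty_localCohomology_zero_equiv (M : ModuleCat.{u} R) :
    Nonempty ((localCohomology J 0).obj M ≃ₗ[R] torsionPowers J M) :=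
  ⟨(localCohomologyObjIso J 0 M ≪≫
    HasColimit.isoOfNatIso (extPowersZeroIso J M).symm).toLinearEquiv.trans
      (colimitHomPowersEquiv J M)⟩

/-- Exactness of `Hom(X, E) → Hom(X, N) → Ext^1(X, M)` for `0 → M → E → N → 0`. -/
theorem leftDerivedδ_zero_exact (hS : S.ShortExact) (X : ModuleCat.{u} R) :
    Function.Exact ((homOpMap S.g).app X).unop.hom
      (((homOp S.X₃).fromLeftDerivedZero.app X).unop ≫
        ((leftDerivedδ (homOpMap S.g) (homOpMap S.f) (homOpMap_comp S)
          (fun X _ => homOpMap_shortExact hS X) 0).app X).unop).hom := by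
  have h1 := leftDerivedδ_exact (homOpMap S.g) (homOpMap S.f) (homOpMap_comp S)
    (fun X _ => homOpMap_shortExact hS X) 0 X
  have h2 : _ = (homOp S.X₃).fromLeftDerivedZero.app X ≫ (homOpMap S.g).app X :=
    congr_app (leftDerived_zero_comp_fromLeftDerivedZero (homOpMap S.g)) X
  have h3 : (leftDerivedδ (homOpMap S.g) (homOpMap S.f) (homOpMap_comp S)
      (fun X _ => homOpMap_shortExact hS X) 0).app X ≫
        (homOp S.X₃).fromLeftDerivedZero.app X ≫ (homOpMap S.g).app X = 0 := by
    have h4 := congr_app (leftDerivedδ_comp (homOpMap S.g) (homOpMap S.f) (homOpMap_comp S)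
      (fun X _ => homOpMap_shortExact hS X) 0) X
    rw [NatTrans.comp_app] at h4
    rw [← h2, NatTrans.comp_app, reassoc_of% h4]
    exact zero_comp
  have h5 : (ShortComplex.mk _ _ ((Category.assoc _ _ _).trans h3)).Exact := by
    refine (ShortComplex.exact_iff_of_iso ?_).1 h1
    refine ShortComplex.isoMk (Iso.refl _)
      ((homOp S.X₃).leftDerivedZeroIsoSelf.app X) ((homOp S.X₂).leftDerivedZeroIsoSelf.app X) ?_ ?_
    · exact Category.id_comp _
    · exact h2.symm
  exact (ShortComplex.ShortExact.moduleCat_exact_iff_function_exact _).1 h5.unop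

/-- Dimension shifting in degree one: `H^1` is the cokernel of the map on the zeroth local
cohomology modules. -/
theorem nonempty_localCohomology_one_equiv (hS : S.ShortExact) [Injective S.X₂] :
    Nonempty ((localCohomology J 1).obj S.X₁ ≃ₗ[R]
      torsionPowers J S.X₃ ⧸ LinearMap.range (torsionPowersMap J S.g.hom)) := by
  let δ := leftDerivedδ (homOpMap S.g) (homOpMap S.f) (homOpMap_comp S)
    (fun X _ => homOpMap_shortExact hS X) 0
  let f : homPowers J S.X₂ ⟶ homPowers J S.X₃ :=
    Functor.whiskerLeft (quotPowers J) ((linearYoneda R (ModuleCat.{u} R)).map S.g)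
  let g : homPowers J S.X₃ ⟶ extPowers J 1 S.X₁ :=
    (extPowersZeroIso J S.X₃).hom ≫ Functor.whiskerLeft (quotPowers J) (NatTrans.leftOp δ)
  have hg (t) : Function.Surjective (g.app t).hom := by
    have h1 : Mono (δ.app (quotPowers J |>.obj t).unop) :=
      mono_leftDerivedδ_app (isZero_leftDerived_homOp S.X₂ 0 _)
    have h2 : Epi (δ.app (quotPowers J |>.obj t).unop).unop := inferInstance
    have h3 : Epi (g.app t) := by
      change Epi ((extPowersZeroIso J S.X₃).hom.app t ≫ (δ.app (quotPowers J |>.obj t).unop).unop)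
      infer_instance
    exact (ModuleCat.epi_iff_surjective _).1 h3
  have hfg (t) : Function.Exact (f.app t).hom (g.app t).hom :=
    leftDerivedδ_zero_exact hS (quotPowers J |>.obj t).unop
  have e1 := (localCohomologyObjIso J 1 S.X₁).toLinearEquiv
  have e2 := (colimMap g).hom.quotKerEquivOfSurjective (colimMap_surjective g hg)
  refine ⟨e1.trans (e2.symm.trans
    (Submodule.Quotient.equiv _ _ (colimitHomPowersEquiv J S.X₃) ?_))⟩
  rw [(colimMap_exact f g hfg).linearMap_ker_eq, ← LinearMap.range_comp,
    colimitHomPowersEquiv_naturality, LinearMap.range_comp, LinearEquiv.range, Submodule.map_top]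

end LocalCohomology

end ExtColimits

/-! ### The total complex of a cube of modules -/

section Cube

variable {R : Type*} [CommRing R] {ι : Type*} [LinearOrder ι]

/-- The sign with which `T \ {j}` contributes to `T` in a Čech complex. -/
def cechSign (T : Finset ι) (j : ι) : ℤ := (-1) ^ (T.filter (· < j)).card

theorem cechSign_mul_self (T : Finset ι) (j : ι) : cechSign T j * cechSign T j = 1 := by
  rw [cechSign, ← mul_pow, neg_mul_neg, one_mul, one_pow]

theorem cechSign_erase_of_lt {T : Finset ι} {j k : ι} (h : k < j) :
    cechSign (T.erase j) k = cechSign T k := by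
  rw [cechSign, cechSign, Finset.filter_erase, Finset.erase_eq_of_notMem]
  simp [h.le]

theorem cechSign_erase_of_gt {T : Finset ι} {j k : ι} (hj : j ∈ T) (h : j < k) :
    cechSign (T.erase j) k = -cechSign T k := by
  have : j ∈ T.filter (· < k) := by simp [hj, h]
  rw [cechSign, cechSign, Finset.filter_erase, ← Finset.card_erase_add_one this, pow_succ]
  ring

theorem cechSign_mul_cechSign_erase {T : Finset ι} {j k : ι} (hj : j ∈ T) (hk : k ∈ T)
    (h : j ≠ k) :
    cechSign T j * cechSign (T.erase j) k = -(cechSign T k * cechSign (T.erase k) j) := by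
  rcases h.lt_or_gt with h | h
  · rw [cechSign_erase_of_gt hj h, cechSign_erase_of_lt h]
    ring
  · rw [cechSign_erase_of_gt hk h, cechSign_erase_of_lt h]
    ring

variable {C : Finset ι → Type*} [∀ T, AddCommGroup (C T)] [∀ T, Module R (C T)]
  (ρ : ∀ {T T' : Finset ι}, T ⊆ T' → C T →ₗ[R] C T')

/-- The differential of the cochain complex attached to a family of modules indexed by finite sets
with transition maps `ρ`, with the signs of the Čech complex. -/
def cubeD (t : ℕ) : ((T : {T : Finset ι // T.card = t}) → C T.1) →ₗ[R]
    ((T : {T : Finset ι // T.card = t + 1}) → C T.1) :=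
  LinearMap.pi fun T' => ∑ j : {j // j ∈ T'.1},
    cechSign T'.1 j.1 • (ρ (Finset.erase_subset j.1 T'.1) ∘ₗ
      LinearMap.proj (R := R) (φ := fun T : {T : Finset ι // T.card = t} => C T.1)
        ⟨T'.1.erase j.1, by rw [Finset.card_erase_of_mem j.2, T'.2, Nat.add_sub_cancel]⟩)

theorem cubeD_apply (t : ℕ) (x : (T : {T : Finset ι // T.card = t}) → C T.1)
    (T' : {T : Finset ι // T.card = t + 1}) :
    cubeD ρ t x T' = ∑ j : {j // j ∈ T'.1}, cechSign T'.1 j.1 • ρ (Finset.erase_subset j.1 T'.1)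
      (x ⟨T'.1.erase j.1, by rw [Finset.card_erase_of_mem j.2, T'.2, Nat.add_sub_cancel]⟩) := by
  simp [cubeD, LinearMap.sum_apply]

variable (hρ : ∀ {T T' T'' : Finset ι} (h : T ⊆ T') (h' : T' ⊆ T'') (x : C T),
  ρ h' (ρ h x) = ρ (h.trans h') x)

include hρ in
/-- Deleting `j` and `k` in either order gives terms that cancel. -/
theorem cubeD_cubeD (t : ℕ) (x : (T : {T : Finset ι // T.card = t}) → C T.1) :
    cubeD ρ (t + 1) (cubeD ρ t x) = 0 := by
  have key (U V T : Finset ι) (h : U = V) (hU : U ⊆ T) (hV : V ⊆ T) (cU : U.card = t)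
      (cV : V.card = t) : ρ hU (x ⟨U, cU⟩) = ρ hV (x ⟨V, cV⟩) := by
    subst h
    rfl
  funext T
  simp only [cubeD_apply, map_sum, map_zsmul, hρ, Finset.smul_sum, smul_smul, Pi.zero_apply]
  rw [Finset.sum_sigma']
  refine Finset.sum_involution (fun a _ => ⟨⟨a.2.1, Finset.mem_of_mem_erase a.2.2⟩, ⟨a.1.1,
    Finset.mem_erase.2 ⟨(Finset.ne_of_mem_erase a.2.2).symm, a.1.2⟩⟩⟩) ?_ ?_ ?_ ?_
  · rintro ⟨⟨j, hj⟩, ⟨k, hk⟩⟩ -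
    dsimp only
    rw [cechSign_mul_cechSign_erase hj (Finset.mem_of_mem_erase hk)
      (Finset.ne_of_mem_erase hk).symm, neg_smul, neg_add_eq_zero]
    congr 1
    exact key _ _ _ (Finset.erase_right_comm) _ _ _ _
  · rintro ⟨⟨j, hj⟩, ⟨k, hk⟩⟩ - - h
    have := congrArg (fun a => a.1.1) h
    exact Finset.ne_of_mem_erase hk this
  · intro a _
    exact Finset.mem_univ _
  · intro a _
    rfl

variable (hlift : ∀ (S : Finset ι) {T' T : Finset ι} (h : T' ⊆ T) (z : C T),
  (∀ s ∈ S, ρ (Finset.subset_insert s T) z = 0) →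
    ∃ z' : C T', (∀ s ∈ S, ρ (Finset.subset_insert s T') z' = 0) ∧ ρ h z' = z)

include hρ hlift in
/-- Suppose that the elements killed by the transition maps in the directions of `S` can always be
lifted to elements killed in the same directions. Then every cocycle can be changed by a coboundary
to vanish on the sets that meet `S`; it is then killed in the directions of `S`, and this is carried
along in the induction on `S`. -/
theorem exists_cubeD_sub_eq_zero (t : ℕ) (c : (T : {T : Finset ι // T.card = t + 1}) → C T.1)
    (hc : cubeD ρ (t + 1) c = 0) (S : Finset ι) :
    ∃ b : (T : {T : Finset ι // T.card = t}) → C T.1, ∀ T : {T : Finset ι // T.card = t + 1},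
      ((∃ s ∈ S, s ∈ T.1) → c T = cubeD ρ t b T) ∧
        ∀ s ∈ S, ρ (Finset.subset_insert s T.1) (c T) =
          ρ (Finset.subset_insert s T.1) (cubeD ρ t b T) := by
  classical
  induction S using Finset.induction_on with
  | empty => exact ⟨0, by simp⟩
  | insert s S hs ih =>
    obtain ⟨b₀, hb₀⟩ := ih
    set c' := c - cubeD ρ t b₀ with hc'
    have hdc' : cubeD ρ (t + 1) c' = 0 := by
      rw [hc', map_sub, hc, cubeD_cubeD ρ hρ, sub_zero]
    have h1 (T) (h : ∃ s ∈ S, s ∈ T.1) : c' T = 0 := sub_eq_zero.2 ((hb₀ T).1 h)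
    have h2 (T) (σ) (hσ : σ ∈ S) : ρ (Finset.subset_insert σ T.1) (c' T) = 0 := by
      rw [hc', Pi.sub_apply, map_sub, (hb₀ T).2 σ hσ, sub_self]
    -- The correcting cochain `b` has a lift of `± c' (insert s T')` at the sets `T'` that do not
    -- meet `insert s S`, and zero elsewhere.
    have hex (T' : {T : Finset ι // T.card = t}) : ∃ z : C T'.1,
        (∀ σ ∈ S, ρ (Finset.subset_insert σ T'.1) z = 0) ∧
        ((∃ σ ∈ insert s S, σ ∈ T'.1) → z = 0) ∧
        ∀ (T : {T : Finset ι // T.card = t + 1}) (h : T'.1 ⊆ T.1), s ∈ T.1 →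
          T.1.erase s = T'.1 → ρ h z = cechSign T.1 s • c' T := by
      by_cases hT' : ∃ σ ∈ insert s S, σ ∈ T'.1
      · refine ⟨0, fun _ _ => map_zero _, fun _ => rfl, fun T h hsT he => ?_⟩
        obtain ⟨σ, hσ, hσT⟩ := hT'
        rcases Finset.mem_insert.1 hσ with rfl | hσ
        · rw [← he] at hσT
          exact absurd rfl (Finset.ne_of_mem_erase hσT)
        · rw [map_zero, h1 T ⟨σ, hσ, h hσT⟩, smul_zero]
      · have hsT' : s ∉ T'.1 := fun h => hT' ⟨s, Finset.mem_insert_self s S, h⟩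
        let T : {T : Finset ι // T.card = t + 1} :=
          ⟨insert s T'.1, by rw [Finset.card_insert_of_notMem hsT', T'.2]⟩
        obtain ⟨z, hz, hz'⟩ := hlift S (Finset.subset_insert s T'.1) (cechSign T.1 s • c' T)
          fun σ hσ => by rw [map_zsmul, h2 T σ hσ, smul_zero]
        refine ⟨z, hz, fun h => absurd h hT', ?_⟩
        rintro ⟨U, hU⟩ h hsU he
        obtain rfl : U = insert s T'.1 :=
          (Finset.insert_erase hsU).symm.trans (congrArg (insert s) he)
        exact hz'
    choose b hb1 hb2 hb3 using hex
    -- By the choice of `b`, its coboundary agrees with `c'` on the sets that meet `insert s S`: at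
    -- a set containing `s` only the face opposite to `s` contributes, and at the other sets `c'` is
    -- zero and `b` is killed in the direction of the only possible face.
    have hdb (T : {T : Finset ι // T.card = t + 1}) (h : ∃ σ ∈ insert s S, σ ∈ T.1) :
        cubeD ρ t b T = c' T := by
      rw [cubeD_apply]
      by_cases hsT : s ∈ T.1
      · rw [Finset.sum_eq_single ⟨s, hsT⟩]
        · rw [hb3 ⟨T.1.erase s, by rw [Finset.card_erase_of_mem hsT, T.2, Nat.add_sub_cancel]⟩
            T (Finset.erase_subset s T.1) hsT rfl, smul_smul, cechSign_mul_self, one_smul]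
        · rintro ⟨j, hj⟩ - hjs
          rw [hb2 _ ⟨s, Finset.mem_insert_self s S, Finset.mem_erase.2
            ⟨fun h => hjs (Subtype.ext h.symm), hsT⟩⟩, map_zero, smul_zero]
        · exact fun h => absurd (Finset.mem_univ _) h
      · obtain ⟨σ, hσ, hσT⟩ := h
        have hσS : σ ∈ S := by
          rcases Finset.mem_insert.1 hσ with rfl | h
          · exact absurd hσT hsT
          · exact h
        rw [h1 T ⟨σ, hσS, hσT⟩]
        refine Finset.sum_eq_zero ?_
        rintro ⟨j, hj⟩ -
        by_cases hjS : j ∈ S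
        · have h3 := hb1 ⟨T.1.erase j, by
            rw [Finset.card_erase_of_mem hj, T.2, Nat.add_sub_cancel]⟩ j hjS
          have h4 : insert j (T.1.erase j) ⊆ T.1 := (Finset.insert_erase hj).subset
          rw [← hρ (Finset.subset_insert j _) h4, h3, map_zero, smul_zero]
        · rw [hb2 _ ⟨σ, hσ, Finset.mem_erase.2 ⟨fun h : σ = j => hjS (h ▸ hσS), hσT⟩⟩, map_zero,
            smul_zero]
    have hzero (T : {T : Finset ι // T.card = t + 1}) (h : ∃ σ ∈ insert s S, σ ∈ T.1) :
        c T = cubeD ρ t (b₀ + b) T := by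
      rw [map_add, Pi.add_apply, hdb T h, hc', Pi.sub_apply, add_sub_cancel]
    refine ⟨b₀ + b, fun T => ⟨hzero T, fun σ hσ => ?_⟩⟩
    by_cases hT : ∃ σ ∈ insert s S, σ ∈ T.1
    · rw [hzero T hT]
    · rcases Finset.mem_insert.1 hσ with rfl | hσS
      · have hσT : σ ∉ T.1 := fun h => hT ⟨σ, hσ, h⟩
        let T₁ : {T : Finset ι // T.card = t + 1 + 1} :=
          ⟨insert σ T.1, by rw [Finset.card_insert_of_notMem hσT, T.2]⟩
        -- All the other terms of the cocycle condition at `insert σ T` vanish already.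
        have hd : cubeD ρ (t + 1) (c - cubeD ρ t (b₀ + b)) T₁ = 0 := by
          rw [map_sub, hc, cubeD_cubeD ρ hρ, sub_zero, Pi.zero_apply]
        have hσT₁ : σ ∈ T₁.1 := Finset.mem_insert_self σ T.1
        rw [cubeD_apply, Finset.sum_eq_single ⟨σ, hσT₁⟩] at hd
        · have key (U : {T : Finset ι // T.card = t + 1}) (hU : U = T) (h : U.1 ⊆ T₁.1)
              (h' : ρ h ((c - cubeD ρ t (b₀ + b)) U) = 0) :
              ρ (Finset.subset_insert σ T.1) ((c - cubeD ρ t (b₀ + b)) T) = 0 := by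
            subst hU
            exact h'
          have hd' := congrArg (cechSign T₁.1 σ • ·) hd
          simp only [smul_smul, cechSign_mul_self, one_smul, smul_zero] at hd'
          have := key ⟨T₁.1.erase σ, _⟩ (Subtype.ext (Finset.erase_insert hσT)) _ hd'
          rwa [Pi.sub_apply, map_sub, sub_eq_zero] at this
        · rintro ⟨j, hj⟩ - hjσ
          rw [Pi.sub_apply, hzero _ ⟨σ, Finset.mem_insert_self σ S, Finset.mem_erase.2
            ⟨fun h => hjσ (Subtype.ext h.symm), hσT₁⟩⟩, sub_self, map_zero, smul_zero]
        · exact fun h => absurd (Finset.mem_univ _) h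
      · have hdb0 : ρ (Finset.subset_insert σ T.1) (cubeD ρ t b T) = 0 := by
          rw [cubeD_apply, map_sum]
          refine Finset.sum_eq_zero ?_
          rintro ⟨j, hj⟩ -
          have h3 := hb1 ⟨T.1.erase j, by
            rw [Finset.card_erase_of_mem hj, T.2, Nat.add_sub_cancel]⟩ σ hσS
          have h4 : insert σ (T.1.erase j) ⊆ insert σ T.1 :=
            Finset.insert_subset_insert σ (Finset.erase_subset j T.1)
          rw [map_zsmul, hρ, ← hρ (Finset.subset_insert σ _) h4, h3, map_zero, smul_zero]
        rw [map_add, Pi.add_apply, map_add, hdb0, add_zero, (hb₀ T).2 σ hσS]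

include hρ hlift in
theorem exists_cubeD_eq [Fintype ι] (t : ℕ) (c : (T : {T : Finset ι // T.card = t + 1}) → C T.1)
    (hc : cubeD ρ (t + 1) c = 0) : ∃ b, cubeD ρ t b = c := by
  obtain ⟨b, hb⟩ := exists_cubeD_sub_eq_zero ρ hρ hlift t c hc Finset.univ
  refine ⟨b, funext fun T => ((hb T).1 ?_).symm⟩
  have hT : 0 < T.1.card := by rw [T.2]; exact Nat.succ_pos t
  obtain ⟨s, hs⟩ := Finset.card_pos.1 hT
  exact ⟨s, Finset.mem_univ s, hs⟩

end Cube

/-! ### Localizations of injective modules -/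

section InjectiveModules

variable {R : Type u} [CommRing R]

/-- In an injective module over a Noetherian ring, every element becomes divisible by the powers
of `y` after multiplication with a suitable power of `y`, and the quotient can be taken to be
annihilated by whatever annihilates the element. -/
theorem exists_pow_add_smul_eq [IsNoetherianRing R] {E : Type u} [AddCommGroup E] [Module R E]
    (hE : Module.Injective R E) (y : R) (k : ℕ) (e : E) :
    ∃ (N : ℕ) (e' : E), y ^ (N + k) • e' = y ^ N • e ∧ ∀ r : R, r • e = 0 → r • e' = 0 := by
  let I : ℕ →o Ideal R :=
    { toFun N := LinearMap.ker (LinearMap.toSpanSingleton R E (y ^ N • e))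
      monotone' := by
        intro a b hab r hr
        simp only [LinearMap.mem_ker, LinearMap.toSpanSingleton_apply] at hr ⊢
        obtain ⟨c, rfl⟩ := Nat.exists_eq_add_of_le hab
        rw [add_comm, pow_add, mul_smul, smul_comm, hr, smul_zero] }
  obtain ⟨N, hN⟩ := monotone_stabilizes_iff_noetherian.2 ‹IsNoetherianRing R› I
  have hN' : I (N + k) ≤ I N := (hN (N + k) (Nat.le_add_right N k)).ge
  -- `r ↦ r • y ^ (N + k) • e` and `r ↦ r • y ^ N • e` have the same kernel, so that the second map
  -- extends along the first; `e'` is the image of `e` under the extension.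
  let i : (R ⧸ I (N + k)) →ₗ[R] E := (I (N + k)).liftQ _ le_rfl
  have hi : Function.Injective i := by
    rw [← LinearMap.ker_eq_bot]
    exact Submodule.ker_liftQ_eq_bot _ _ _ le_rfl
  let f : (R ⧸ I (N + k)) →ₗ[R] E :=
    (I (N + k)).liftQ (LinearMap.toSpanSingleton R E (y ^ N • e)) hN'
  obtain ⟨h, hh⟩ := hE.out i hi f
  refine ⟨N, h e, ?_, fun r hr => by rw [← map_smul, hr, map_zero]⟩
  have h1 := hh (Submodule.Quotient.mk 1)
  simp only [i, f, Submodule.liftQ_apply, LinearMap.toSpanSingleton_apply, one_smul] at h1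
  rw [← h1, map_smul]

theorem pow_smul_pow_smul_pow_smul {M : Type*} [AddCommGroup M] [Module R M] (r : R) (a b c : ℕ)
    (x : M) : r ^ a • r ^ b • r ^ c • x = r ^ (a + (b + c)) • x := by
  rw [pow_add, pow_add, mul_smul, mul_smul]

end InjectiveModules

section CechModule

open TensorProduct

variable (K : Type u) [Field K] {m n : ℕ} (Δ : SComplex (Fin m ⊕ Fin n))

/-- The localization `M_{y_T}` of a module over the Stanley-Reisner ring. -/
abbrev CechMod (M : Type u) [AddCommGroup M] [Module (SRRing K Δ) M] (T : Finset (Fin n)) :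
    Type u :=
  CechLoc K Δ T ⊗[SRRing K Δ] M

variable (M : Type u) [AddCommGroup M] [Module (SRRing K Δ) M]

/-- The natural map `M_{y_T} → M_{y_{T'}}` for `T ⊆ T'`. -/
def cechModNat {T T' : Finset (Fin n)} (h : T ⊆ T') :
    CechMod K Δ M T →ₗ[SRRing K Δ] CechMod K Δ M T' :=
  (cechNat K Δ h).toLinearMap.rTensor M

/-- The natural map `M → M_{y_T}`. -/
def cechModMk (T : Finset (Fin n)) : M →ₗ[SRRing K Δ] CechMod K Δ M T :=
  TensorProduct.mk (SRRing K Δ) (CechLoc K Δ T) M 1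

theorem cechNat_cechNat {T T' T'' : Finset (Fin n)} (h : T ⊆ T') (h' : T' ⊆ T'')
    (z : CechLoc K Δ T) : cechNat K Δ h' (cechNat K Δ h z) = cechNat K Δ (h.trans h') z := by
  have := IsLocalization.algHom_subsingleton (Submonoid.powers (yProd K Δ T))
    (S := CechLoc K Δ T) (P := CechLoc K Δ T'') (R := SRRing K Δ)
  exact DFunLike.congr_fun (Subsingleton.elim ((cechNat K Δ h').comp (cechNat K Δ h)) _) z

theorem cechModNat_cechModNat {T T' T'' : Finset (Fin n)} (h : T ⊆ T') (h' : T' ⊆ T'')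
    (z : CechMod K Δ M T) :
    cechModNat K Δ M h' (cechModNat K Δ M h z) = cechModNat K Δ M (h.trans h') z := by
  rw [cechModNat, cechModNat, ← LinearMap.comp_apply, ← LinearMap.rTensor_comp, cechModNat]
  congr 2
  ext z
  exact cechNat_cechNat K Δ h h' z

@[simp]
theorem cechModNat_mk {T T' : Finset (Fin n)} (h : T ⊆ T') (x : M) :
    cechModNat K Δ M h (cechModMk K Δ M T x) = cechModMk K Δ M T' x := by
  simp [cechModNat, cechModMk]

instance (T : Finset (Fin n)) :
    IsLocalizedModule (Submonoid.powers (yProd K Δ T)) (cechModMk K Δ M T) :=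
  (isLocalizedModule_iff_isBaseChange (Submonoid.powers (yProd K Δ T)) (CechLoc K Δ T) _).2
    (TensorProduct.isBaseChange (SRRing K Δ) M (CechLoc K Δ T))

variable {K Δ M}

theorem exists_pow_smul_eq_cechModMk {T : Finset (Fin n)} (z : CechMod K Δ M T) :
    ∃ (k : ℕ) (x : M), yProd K Δ T ^ k • z = cechModMk K Δ M T x := by
  obtain ⟨⟨x, ⟨_, k, rfl⟩⟩, h⟩ :=
    IsLocalizedModule.surj (Submonoid.powers (yProd K Δ T)) (cechModMk K Δ M T) z
  exact ⟨k, x, h⟩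

theorem cechModMk_eq_zero_iff {T : Finset (Fin n)} {x : M} :
    cechModMk K Δ M T x = 0 ↔ ∃ k : ℕ, yProd K Δ T ^ k • x = 0 := by
  rw [← map_zero (cechModMk K Δ M T),
    IsLocalizedModule.eq_iff_exists (Submonoid.powers (yProd K Δ T))]
  constructor
  · rintro ⟨⟨_, k, rfl⟩, h⟩
    exact ⟨k, h.trans (smul_zero _)⟩
  · rintro ⟨k, h⟩
    exact ⟨⟨_, k, rfl⟩, h.trans (smul_zero _).symm⟩

theorem pow_smul_injective {T : Finset (Fin n)} (k : ℕ) :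
    Function.Injective fun z : CechMod K Δ M T => yProd K Δ T ^ k • z :=
  ((Module.End.isUnit_iff _).1 (IsLocalizedModule.map_units (cechModMk K Δ M T)
    (⟨_, k, rfl⟩ : Submonoid.powers (yProd K Δ T)))).1

/-- Injective modules satisfy the lifting hypothesis of `exists_cubeD_eq`. -/
theorem exists_cechModNat_eq (hM : Module.Injective (SRRing K Δ) M) (S : Finset (Fin n))
    {T' T : Finset (Fin n)} (h : T' ⊆ T) (z : CechMod K Δ M T)
    (hz : ∀ s ∈ S, cechModNat K Δ M (Finset.subset_insert s T) z = 0) :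
    ∃ z' : CechMod K Δ M T', (∀ s ∈ S, cechModNat K Δ M (Finset.subset_insert s T') z' = 0) ∧
      cechModNat K Δ M h z' = z := by
  obtain ⟨k, x, hx⟩ := exists_pow_smul_eq_cechModMk z
  have h1 (s) (hs : s ∈ S) : ∃ N : ℕ, yProd K Δ (insert s T) ^ N • x = 0 := by
    rw [← cechModMk_eq_zero_iff, ← cechModNat_mk K Δ M (Finset.subset_insert s T), ← hx, map_smul,
      hz s hs, smul_zero]
  choose! N hN using h1
  -- For large `B` the numerator `y_T ^ B • x` is killed by `y_s ^ B` for all `s ∈ S`, and so is any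
  -- element with a larger annihilator.
  obtain ⟨B, hB⟩ : ∃ B, ∀ s ∈ S, N s ≤ B := ⟨S.sup N, fun s hs => Finset.le_sup hs⟩
  have h2 (s) (hs : s ∈ S) : y K Δ s ^ B • yProd K Δ T ^ B • x = 0 := by
    have h3 : yProd K Δ (insert s T) ∣ y K Δ s * yProd K Δ T := by
      by_cases hsT : s ∈ T
      · rw [Finset.insert_eq_of_mem hsT]
        exact dvd_mul_left _ _
      · rw [yProd, Finset.prod_insert hsT]
        exact dvd_rfl
    obtain ⟨c, hc⟩ := (pow_dvd_pow _ (hB s hs)).trans (pow_dvd_pow_of_dvd h3 B)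
    rw [← mul_smul, ← mul_pow, hc, mul_comm, mul_smul, hN s hs, smul_zero]
  obtain ⟨L, x', hx', hann⟩ := exists_pow_add_smul_eq hM (yProd K Δ T) (B + k)
    (yProd K Δ T ^ B • x)
  refine ⟨cechModMk K Δ M T' x', fun s hs => ?_, ?_⟩
  · rw [cechModNat_mk, cechModMk_eq_zero_iff]
    refine ⟨B, ?_⟩
    obtain ⟨c, hc⟩ := pow_dvd_pow_of_dvd (Finset.dvd_prod_of_mem (y K Δ)
      (Finset.mem_insert_self s T')) B
    rw [yProd, hc, mul_comm, mul_smul, hann _ (h2 s hs), smul_zero]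
  · apply pow_smul_injective (L + (B + k))
    dsimp only
    rw [cechModNat_mk, ← map_smul, hx', map_smul, map_smul, ← hx]
    exact pow_smul_pow_smul_pow_smul _ L B k z

end CechModule

/-! ### The Čech complex of a module and its cohomology -/

section CechComplex

open TensorProduct CategoryTheory

variable (K : Type u) [Field K] {m n : ℕ} (Δ : SComplex (Fin m ⊕ Fin n))

/-- The differential of the Čech complex of a module. -/
abbrev cechModD (M : Type u) [AddCommGroup M] [Module (SRRing K Δ) M] (t : ℕ) :
    ((T : {T : Finset (Fin n) // T.card = t}) → CechMod K Δ M T.1) →ₗ[SRRing K Δ]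
      ((T : {T : Finset (Fin n) // T.card = t + 1}) → CechMod K Δ M T.1) :=
  cubeD (fun {_ _} => cechModNat K Δ M) t

theorem cechModD_cechModD (M : Type u) [AddCommGroup M] [Module (SRRing K Δ) M] (t : ℕ)
    (x : (T : {T : Finset (Fin n) // T.card = t}) → CechMod K Δ M T.1) :
    cechModD K Δ M (t + 1) (cechModD K Δ M t x) = 0 :=
  cubeD_cubeD _ (fun h h' x => cechModNat_cechModNat K Δ M h h' x) t x

/-- The Čech complex of a module over the Stanley-Reisner ring. -/
def cechComplex (M : ModuleCat.{u} (SRRing K Δ)) : CochainComplex (ModuleCat.{u} (SRRing K Δ)) ℕ :=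
  CochainComplex.of
    (fun t => ModuleCat.of _ ((T : {T : Finset (Fin n) // T.card = t}) → CechMod K Δ M T.1))
    (fun t => ModuleCat.ofHom (cechModD K Δ M t))
    (fun t => ModuleCat.hom_ext (LinearMap.ext fun x => cechModD_cechModD K Δ M t x))

theorem cechComplex_d (M : ModuleCat.{u} (SRRing K Δ)) (t : ℕ) :
    (cechComplex K Δ M).d t (t + 1) = ModuleCat.ofHom (cechModD K Δ M t) := by
  exact CochainComplex.of_d (fun t => ModuleCat.of (SRRing K Δ)
    ((T : {T : Finset (Fin n) // T.card = t}) → CechMod K Δ M T.1))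
    (fun t => ModuleCat.ofHom (cechModD K Δ M t)) t

/-- The map of Čech cochains induced by a linear map. -/
def cechModMap {M N : Type u} [AddCommGroup M] [Module (SRRing K Δ) M] [AddCommGroup N]
    [Module (SRRing K Δ) N] (f : M →ₗ[SRRing K Δ] N) (t : ℕ) :
    ((T : {T : Finset (Fin n) // T.card = t}) → CechMod K Δ M T.1) →ₗ[SRRing K Δ]
      ((T : {T : Finset (Fin n) // T.card = t}) → CechMod K Δ N T.1) :=
  LinearMap.pi fun T => f.lTensor (CechLoc K Δ T.1) ∘ₗ LinearMap.proj T

variable {K Δ} in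
theorem lTensor_cechModNat {M N : Type u} [AddCommGroup M] [Module (SRRing K Δ) M]
    [AddCommGroup N] [Module (SRRing K Δ) N] (f : M →ₗ[SRRing K Δ] N) {T T' : Finset (Fin n)}
    (h : T ⊆ T') (z : CechMod K Δ M T) :
    f.lTensor (CechLoc K Δ T') (cechModNat K Δ M h z) =
      cechModNat K Δ N h (f.lTensor (CechLoc K Δ T) z) := by
  rw [cechModNat, cechModNat, ← LinearMap.comp_apply, ← LinearMap.comp_apply,
    LinearMap.lTensor_comp_rTensor, LinearMap.rTensor_comp_lTensor]

theorem cechModMap_cechModD {M N : Type u} [AddCommGroup M] [Module (SRRing K Δ) M]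
    [AddCommGroup N] [Module (SRRing K Δ) N] (f : M →ₗ[SRRing K Δ] N) (t : ℕ)
    (x : (T : {T : Finset (Fin n) // T.card = t}) → CechMod K Δ M T.1) :
    cechModMap K Δ f (t + 1) (cechModD K Δ M t x) = cechModD K Δ N t (cechModMap K Δ f t x) := by
  funext T
  refine Eq.trans (congrArg (f.lTensor (CechLoc K Δ T.1)) (cubeD_apply _ t x T)) ?_
  rw [cechModD, cubeD_apply, map_sum]
  refine Finset.sum_congr rfl fun j _ => ?_
  rw [map_zsmul, lTensor_cechModNat]
  rfl

/-- The map of Čech complexes induced by a linear map. -/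
def cechComplexMap {M N : ModuleCat.{u} (SRRing K Δ)} (f : M ⟶ N) :
    cechComplex K Δ M ⟶ cechComplex K Δ N where
  f t := ModuleCat.ofHom (cechModMap K Δ f.hom t)
  comm' := by
    rintro i _ rfl
    rw [cechComplex_d, cechComplex_d]
    exact ModuleCat.hom_ext (LinearMap.ext fun x => (cechModMap_cechModD K Δ f.hom i x).symm)

/-- The sequence of Čech complexes attached to a sequence of modules. -/
@[simps]
def cechSequence (S : ShortComplex (ModuleCat.{u} (SRRing K Δ))) :
    ShortComplex (CochainComplex (ModuleCat.{u} (SRRing K Δ)) ℕ) where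
  X₁ := cechComplex K Δ S.X₁
  X₂ := cechComplex K Δ S.X₂
  X₃ := cechComplex K Δ S.X₃
  f := cechComplexMap K Δ S.f
  g := cechComplexMap K Δ S.g
  zero := by
    ext t : 1
    refine ModuleCat.hom_ext (LinearMap.ext fun x => funext fun T => ?_)
    change S.g.hom.lTensor _ (S.f.hom.lTensor _ (x T)) = 0
    rw [← LinearMap.comp_apply, ← LinearMap.lTensor_comp, ← ModuleCat.hom_comp, S.zero,
      ModuleCat.hom_zero, LinearMap.lTensor_zero, LinearMap.zero_apply]

/-- Localizations are flat. -/
theorem cechSequence_shortExact {S : ShortComplex (ModuleCat.{u} (SRRing K Δ))}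
    (hS : S.ShortExact) : (cechSequence K Δ S).ShortExact := by
  refine HomologicalComplex.shortExact_of_degreewise_shortExact _ fun t =>
    ModuleCat.shortComplex_shortExact _ ?_ ?_ ?_
  · have h (T : Finset (Fin n)) := lTensor_exact (CechLoc K Δ T)
      ((ShortComplex.ShortExact.moduleCat_exact_iff_function_exact _).1 hS.exact)
      hS.moduleCat_surjective_g
    intro x
    constructor
    · intro hx
      choose w hw using fun T => (h (Subtype.val T) (x T)).1 (congrFun hx T)
      exact ⟨w, funext hw⟩
    · rintro ⟨w, rfl⟩
      exact funext fun T => (h T.1).apply_apply_eq_zero (w T)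
  · intro a b hab
    funext T
    have : Module.Flat (SRRing K Δ) (CechLoc K Δ T.1) :=
      IsLocalization.flat _ (Submonoid.powers (yProd K Δ T.1))
    exact Module.Flat.lTensor_preserves_injective_linearMap (M := CechLoc K Δ T.1) S.f.hom
      hS.moduleCat_injective_f (congrFun hab T)
  · intro x
    choose w hw using fun T => LinearMap.lTensor_surjective (CechLoc K Δ (Subtype.val T))
      hS.moduleCat_surjective_g (x T)
    exact ⟨w, funext hw⟩

/-- The Čech cohomology of an injective module vanishes in positive degrees. -/
theorem isZero_cechComplex_homology (E : ModuleCat.{u} (SRRing K Δ)) [Injective E] (i : ℕ) :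
    Limits.IsZero ((cechComplex K Δ E).homology (i + 1)) := by
  rw [← HomologicalComplex.exactAt_iff_isZero_homology,
    HomologicalComplex.exactAt_iff' _ i (i + 1) (i + 2) (by simp) (by simp),
    ShortComplex.moduleCat_exact_iff]
  intro x hx
  have hE : Module.Injective (SRRing K Δ) E := Module.injective_module_of_injective_object _ _
  change (cechComplex K Δ E).d (i + 1) (i + 1 + 1) x = 0 at hx
  change ∃ x₁, (cechComplex K Δ E).d i (i + 1) x₁ = x
  rw [cechComplex_d] at hx ⊢
  exact exists_cubeD_eq _ (fun h h' x => cechModNat_cechModNat K Δ E h h' x)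
    (fun S _ _ h z hz => exists_cechModNat_eq hE S h z hz) i x hx

theorem nonempty_cechComplex_homology_succ_iso {S : ShortComplex (ModuleCat.{u} (SRRing K Δ))}
    (hS : S.ShortExact) [Injective S.X₂] (i : ℕ) :
    Nonempty ((cechComplex K Δ S.X₁).homology (i + 2) ≅
      (cechComplex K Δ S.X₃).homology (i + 1)) :=
  ⟨((cechSequence_shortExact K Δ hS).δIso (i + 1) (i + 2) rfl
    (isZero_cechComplex_homology K Δ S.X₂ i) (isZero_cechComplex_homology K Δ S.X₂ (i + 1))).symm⟩

/-- The elements of an ideal power kill `x` as soon as powers of the generators do. -/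
theorem mem_torsionPowers_idealP_iff {M : Type u} [AddCommGroup M] [Module (SRRing K Δ) M]
    (x : M) : x ∈ torsionPowers (idealP K Δ) M ↔ ∀ j, ∃ k : ℕ, y K Δ j ^ k • x = 0 := by
  constructor
  · rintro ⟨t, ht⟩ j
    exact ⟨t, ht _ (Ideal.pow_mem_pow (Ideal.subset_span (Set.mem_range_self j)) t)⟩
  · intro h
    let I : Ideal (SRRing K Δ) := LinearMap.ker (LinearMap.toSpanSingleton (SRRing K Δ) M x)
    have hI : idealP K Δ ≤ I.radical := by
      refine Ideal.span_le.2 ?_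
      rintro _ ⟨j, rfl⟩
      obtain ⟨k, hk⟩ := h j
      exact ⟨k, hk⟩
    obtain ⟨t, ht⟩ := Ideal.exists_pow_le_of_le_radical_of_fg hI
      (Submodule.fg_span (Set.finite_range (y K Δ)))
    exact ⟨t, fun r hr => ht hr⟩

/-- The elements killed by powers of all `y_j`, as cochains of degree zero. -/
def torsionToCech (M : ModuleCat.{u} (SRRing K Δ)) :
    torsionPowers (idealP K Δ) M →ₗ[SRRing K Δ] (cechComplex K Δ M).X 0 :=
  (LinearMap.pi fun T : {T : Finset (Fin n) // T.card = 0} => cechModMk K Δ M T.1) ∘ₗ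
    (torsionPowers (idealP K Δ) M).subtype

theorem torsionToCech_injective (M : ModuleCat.{u} (SRRing K Δ)) :
    Function.Injective (torsionToCech K Δ M) := by
  rw [injective_iff_map_eq_zero]
  intro x hx
  obtain ⟨k, hk⟩ := cechModMk_eq_zero_iff.1 (congrFun hx ⟨∅, rfl⟩)
  rw [yProd, Finset.prod_empty, one_pow, one_smul] at hk
  exact Subtype.ext hk

theorem cechModD_zero_apply (M : Type u) [AddCommGroup M] [Module (SRRing K Δ) M]
    (z : (T : {T : Finset (Fin n) // T.card = 0}) → CechMod K Δ M T.1) (x : M)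
    (hx : z ⟨∅, rfl⟩ = cechModMk K Δ M ∅ x) (T : {T : Finset (Fin n) // T.card = 0 + 1}) (j : Fin n)
    (hj : T.1 = {j}) : cechModD K Δ M 0 z T = cechModMk K Δ M T.1 x := by
  obtain ⟨T, hT⟩ := T
  obtain rfl : T = {j} := hj
  have hz (U : Finset (Fin n)) (hU : U.card = 0) : z ⟨U, hU⟩ = cechModMk K Δ M U x := by
    obtain rfl := Finset.card_eq_zero.1 hU
    exact hx
  rw [cechModD, cubeD_apply, Finset.sum_eq_single ⟨j, Finset.mem_singleton_self j⟩]
  · rw [hz, cechModNat_mk, cechSign, Finset.filter_eq_empty_iff.2, Finset.card_empty, pow_zero,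
      one_smul]
    simp
  · rintro ⟨k, hk⟩ - h
    exact absurd (Subtype.ext (Finset.mem_singleton.1 hk)) h
  · exact fun h => absurd (Finset.mem_univ _) h

/-- The cocycles of degree zero are the elements of `M` that vanish in all `M_{y_j}`. -/
theorem range_torsionToCech (M : ModuleCat.{u} (SRRing K Δ)) :
    LinearMap.range (torsionToCech K Δ M) =
      LinearMap.ker ((cechComplex K Δ M).d 0 1).hom := by
  rw [cechComplex_d]
  ext z
  constructor
  · rintro ⟨x, rfl⟩
    refine funext fun T => ?_
    obtain ⟨j, hj⟩ := Finset.card_eq_one.1 T.2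
    refine (cechModD_zero_apply K Δ M (torsionToCech K Δ M x) x.1 rfl T j hj).trans ?_
    refine cechModMk_eq_zero_iff.2 ?_
    rw [hj, yProd, Finset.prod_singleton]
    exact (mem_torsionPowers_idealP_iff K Δ x.1).1 x.2 j
  · intro hz
    obtain ⟨k, x, hx⟩ := exists_pow_smul_eq_cechModMk (K := K) (Δ := Δ) (T := ∅)
      ((z : (T : {T : Finset (Fin n) // T.card = 0}) → CechMod K Δ M T.1) ⟨∅, rfl⟩)
    have hy : yProd K Δ ∅ ^ k = 1 := by rw [yProd, Finset.prod_empty, one_pow]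
    rw [hy] at hx
    replace hx := (one_smul (SRRing K Δ) _).symm.trans hx
    have hxt : x ∈ torsionPowers (idealP K Δ) M := by
      rw [mem_torsionPowers_idealP_iff]
      intro j
      have h1 := (cechModD_zero_apply K Δ M z x hx ⟨{j}, rfl⟩ j rfl).symm.trans
        (congrFun hz ⟨{j}, rfl⟩)
      obtain ⟨k, hk⟩ := cechModMk_eq_zero_iff.1 h1
      rw [yProd, Finset.prod_singleton] at hk
      exact ⟨k, hk⟩
    refine ⟨⟨x, hxt⟩, funext ?_⟩
    rintro ⟨T, hT⟩
    obtain rfl := Finset.card_eq_zero.1 hT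
    exact hx.symm

/-- Čech classes of degree zero, as cochains. -/
def homologyZeroToCech (M : ModuleCat.{u} (SRRing K Δ)) :
    (cechComplex K Δ M).homology 0 ⟶ (cechComplex K Δ M).X 0 :=
  (cechComplex K Δ M).isoHomologyπ₀.inv ≫ (cechComplex K Δ M).iCycles 0

theorem homologyZeroToCech_injective (M : ModuleCat.{u} (SRRing K Δ)) :
    Function.Injective (homologyZeroToCech K Δ M).hom := by
  have : Mono (homologyZeroToCech K Δ M) := by
    dsimp only [homologyZeroToCech]
    infer_instance
  exact (ModuleCat.mono_iff_injective _).1 this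

theorem range_homologyZeroToCech (M : ModuleCat.{u} (SRRing K Δ)) :
    LinearMap.range (homologyZeroToCech K Δ M).hom =
      LinearMap.ker ((cechComplex K Δ M).d 0 1).hom := by
  have h : homologyZeroToCech K Δ M ≫ (cechComplex K Δ M).d 0 1 = 0 := by
    simp [homologyZeroToCech]
  ext z
  constructor
  · rintro ⟨x, rfl⟩
    exact ConcreteCategory.congr_hom h x
  · intro hz
    let f : ModuleCat.of (SRRing K Δ) (SRRing K Δ) ⟶ (cechComplex K Δ M).X 0 :=
      ModuleCat.ofHom (LinearMap.toSpanSingleton _ _ z)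
    have hf : f ≫ (cechComplex K Δ M).d 0 1 = 0 := by
      refine ModuleCat.hom_ext (LinearMap.ext_ring ?_)
      refine Eq.trans ?_ hz
      exact congrArg ((cechComplex K Δ M).d 0 1).hom (one_smul (SRRing K Δ) z)
    refine ⟨((cechComplex K Δ M).liftCycles f 1 (by simp) hf ≫
      (cechComplex K Δ M).isoHomologyπ₀.hom).hom 1, ?_⟩
    have h2 : ((cechComplex K Δ M).liftCycles f 1 (by simp) hf ≫
      (cechComplex K Δ M).isoHomologyπ₀.hom) ≫ homologyZeroToCech K Δ M = f := by
      simp only [homologyZeroToCech, Category.assoc, Iso.hom_inv_id_assoc,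
        HomologicalComplex.liftCycles_i]
    exact (ConcreteCategory.congr_hom h2 1).trans (one_smul (SRRing K Δ) z)

/-- In degree zero, Čech cohomology consists of the elements killed by a power of `P`. -/
def cechHomologyZeroEquiv (M : ModuleCat.{u} (SRRing K Δ)) :
    (cechComplex K Δ M).homology 0 ≃ₗ[SRRing K Δ] torsionPowers (idealP K Δ) M :=
  (LinearEquiv.ofInjective _ (homologyZeroToCech_injective K Δ M)).trans
    ((LinearEquiv.ofEq _ _ ((range_homologyZeroToCech K Δ M).trans
      (range_torsionToCech K Δ M).symm)).trans
      (LinearEquiv.ofInjective _ (torsionToCech_injective K Δ M)).symm)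

theorem torsionToCech_cechHomologyZeroEquiv (M : ModuleCat.{u} (SRRing K Δ))
    (x : (cechComplex K Δ M).homology 0) :
    torsionToCech K Δ M (cechHomologyZeroEquiv K Δ M x) = (homologyZeroToCech K Δ M).hom x := by
  have h := LinearEquiv.apply_symm_apply
    (LinearEquiv.ofInjective _ (torsionToCech_injective K Δ M))
    (LinearEquiv.ofEq _ _ ((range_homologyZeroToCech K Δ M).trans (range_torsionToCech K Δ M).symm)
      (LinearEquiv.ofInjective _ (homologyZeroToCech_injective K Δ M) x))
  exact congrArg Subtype.val h

theorem cechHomologyZeroEquiv_naturality {M N : ModuleCat.{u} (SRRing K Δ)} (f : M ⟶ N) :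
    (cechHomologyZeroEquiv K Δ N).toLinearMap ∘ₗ
        (HomologicalComplex.homologyMap (cechComplexMap K Δ f) 0).hom =
      torsionPowersMap (idealP K Δ) f.hom ∘ₗ (cechHomologyZeroEquiv K Δ M).toLinearMap := by
  ext x : 1
  apply torsionToCech_injective K Δ N
  refine (torsionToCech_cechHomologyZeroEquiv K Δ N _).trans ?_
  have h1 : HomologicalComplex.homologyMap (cechComplexMap K Δ f) 0 ≫ homologyZeroToCech K Δ N =
      homologyZeroToCech K Δ M ≫ (cechComplexMap K Δ f).f 0 := by
    dsimp only [homologyZeroToCech]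
    rw [CochainComplex.isoHomologyπ₀_inv_naturality_assoc, HomologicalComplex.cyclesMap_i,
      Category.assoc]
  refine (ConcreteCategory.congr_hom h1 x).trans ?_
  refine (congrArg ((cechComplexMap K Δ f).f 0).hom
    (torsionToCech_cechHomologyZeroEquiv K Δ M x).symm).trans ?_
  refine funext fun T => ?_
  exact LinearMap.lTensor_tmul _ _ _ _

theorem nonempty_cechComplex_homology_one_equiv {S : ShortComplex (ModuleCat.{u} (SRRing K Δ))}
    (hS : S.ShortExact) [Injective S.X₂] :
    Nonempty ((cechComplex K Δ S.X₁).homology 1 ≃ₗ[SRRing K Δ]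
      torsionPowers (idealP K Δ) S.X₃ ⧸
        LinearMap.range (torsionPowersMap (idealP K Δ) S.g.hom)) := by
  have hC := cechSequence_shortExact K Δ hS
  let δ : (cechComplex K Δ S.X₃).homology 0 ⟶ (cechComplex K Δ S.X₁).homology 1 := hC.δ 0 1 rfl
  have hepi : Epi δ := hC.epi_δ 0 1 rfl (isZero_cechComplex_homology K Δ S.X₂ 0)
  have hex : Function.Exact (HomologicalComplex.homologyMap (cechComplexMap K Δ S.g) 0).hom
      δ.hom :=
    (ShortComplex.ShortExact.moduleCat_exact_iff_function_exact _).1 (hC.homology_exact₃ 0 1 rfl)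
  have e := δ.hom.quotKerEquivOfSurjective ((ModuleCat.epi_iff_surjective _).1 hepi)
  refine ⟨e.symm.trans (Submodule.Quotient.equiv _ _ (cechHomologyZeroEquiv K Δ S.X₃) ?_)⟩
  rw [hex.linearMap_ker_eq, ← LinearMap.range_comp, cechHomologyZeroEquiv_naturality,
    LinearMap.range_comp, LinearEquiv.range, Submodule.map_top]

/-- Local cohomology is Čech cohomology, for all modules, by dimension shifting. -/
theorem nonempty_localCohomology_equiv_cechComplex_homology (i : ℕ) :
    ∀ M : ModuleCat.{u} (SRRing K Δ),
      Nonempty ((localCohomology (idealP K Δ) i).obj M ≃ₗ[SRRing K Δ]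
        (cechComplex K Δ M).homology i) := by
  have hseq (M : ModuleCat.{u} (SRRing K Δ)) : ∃ S : ShortComplex (ModuleCat.{u} (SRRing K Δ)),
      S.ShortExact ∧ Injective S.X₂ ∧ S.X₁ = M :=
    ⟨ShortComplex.mk (Injective.ι M) (Limits.cokernel.π (Injective.ι M)) (by simp),
      { exact := ShortComplex.exact_cokernel _ },
      (inferInstance : Injective (Injective.under M)), rfl⟩
  induction i using Nat.twoStepInduction with
  | zero =>
    intro M
    obtain ⟨e⟩ := nonempty_localCohomology_zero_equiv (idealP K Δ) M
    exact ⟨e.trans (cechHomologyZeroEquiv K Δ M).symm⟩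
  | one =>
    intro M
    obtain ⟨S, hS, _, rfl⟩ := hseq M
    obtain ⟨e⟩ := nonempty_localCohomology_one_equiv (idealP K Δ) hS
    obtain ⟨e'⟩ := nonempty_cechComplex_homology_one_equiv K Δ hS
    exact ⟨e.trans e'.symm⟩
  | more i _ ih =>
    intro M
    obtain ⟨S, hS, _, rfl⟩ := hseq M
    obtain ⟨e⟩ := nonempty_localCohomology_succ_iso (idealP K Δ) hS i
    obtain ⟨e'⟩ := nonempty_cechComplex_homology_succ_iso K Δ hS i
    obtain ⟨e''⟩ := ih S.X₃
    exact ⟨e.toLinearEquiv.trans (e''.trans e'.symm.toLinearEquiv)⟩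

end CechComplex

/-! ### The Čech complex of the Stanley-Reisner ring -/

section CechCohomology

open TensorProduct CategoryTheory

/-- The homology of a short complex of modules, in terms of a concrete model of its middle term. -/
theorem nonempty_homology_equiv {R : Type u} [CommRing R] (S : ShortComplex (ModuleCat.{u} R))
    {N N' : Type u} [AddCommGroup N] [Module R N] [AddCommGroup N'] [Module R N']
    (e : S.X₂ ≃ₗ[R] N) (D : N →ₗ[R] N') (B : Submodule R N)
    (hD : ∀ x, S.g.hom x = 0 ↔ D (e x) = 0) (hB : ∀ y, y ∈ B ↔ ∃ x, e (S.f.hom x) = y) :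
    Nonempty (S.homology ≃ₗ[R] LinearMap.ker D ⧸ B.submoduleOf (LinearMap.ker D)) := by
  let e' : LinearMap.ker S.g.hom ≃ₗ[R] LinearMap.ker D :=
    e.ofSubmodules _ _ (by
      ext y
      constructor
      · rintro ⟨x, hx, rfl⟩
        exact (hD x).1 hx
      · intro hy
        refine ⟨e.symm y, (hD _).2 ?_, e.apply_symm_apply y⟩
        rw [e.apply_symm_apply]
        exact hy)
  refine ⟨S.moduleCatHomologyIso.toLinearEquiv.trans (Submodule.Quotient.equiv
    (LinearMap.range S.moduleCatToCycles) _ e' ?_)⟩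
  ext ⟨y, hy⟩
  constructor
  · rintro ⟨_, ⟨x, rfl⟩, h⟩
    exact (hB y).2 ⟨x, congrArg Subtype.val h⟩
  · intro h
    obtain ⟨x, hx⟩ := (hB y).1 h
    exact ⟨_, ⟨x, rfl⟩, Subtype.ext hx⟩

variable (K : Type u) [Field K] {m n : ℕ} (Δ : SComplex (Fin m ⊕ Fin n))

theorem cechD_eq_cubeD (t : ℕ) :
    cechD K Δ t = cubeD (fun {_ _} h => (cechNat K Δ h).toLinearMap) t := rfl

/-- The Čech cochains of the ring, regarded as a module over itself. -/
def cechModSelfEquiv (t : ℕ) :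
    ((T : {T : Finset (Fin n) // T.card = t}) → CechMod K Δ (SRRing K Δ) T.1) ≃ₗ[SRRing K Δ]
      CechCochain K Δ t :=
  LinearEquiv.piCongrRight fun T => TensorProduct.rid (SRRing K Δ) (CechLoc K Δ T.1)

theorem rid_cechModNat {T T' : Finset (Fin n)} (h : T ⊆ T') (z : CechMod K Δ (SRRing K Δ) T) :
    TensorProduct.rid (SRRing K Δ) (CechLoc K Δ T') (cechModNat K Δ (SRRing K Δ) h z) =
      cechNat K Δ h (TensorProduct.rid (SRRing K Δ) (CechLoc K Δ T) z) := by
  refine TensorProduct.induction_on z (by simp only [map_zero]) (fun a b => ?_)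
    fun a b ha hb => by simp only [map_add, ha, hb]
  rw [cechModNat, LinearMap.rTensor_tmul, TensorProduct.rid_tmul, TensorProduct.rid_tmul,
    map_smul]
  rfl

theorem cechModSelfEquiv_cechModD (t : ℕ)
    (x : (T : {T : Finset (Fin n) // T.card = t}) → CechMod K Δ (SRRing K Δ) T.1) :
    cechModSelfEquiv K Δ (t + 1) (cechModD K Δ (SRRing K Δ) t x) =
      cechD K Δ t (cechModSelfEquiv K Δ t x) := by
  rw [cechD_eq_cubeD]
  funext T
  rw [cubeD_apply]
  refine Eq.trans (congrArg (TensorProduct.rid (SRRing K Δ) (CechLoc K Δ T.1))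
    (cubeD_apply _ t x T)) ?_
  rw [map_sum]
  refine Finset.sum_congr rfl fun j _ => ?_
  rw [map_zsmul, rid_cechModNat]
  rfl

theorem cechModSelfEquiv_cechComplex_d (t : ℕ)
    (x : (cechComplex K Δ (ModuleCat.of (SRRing K Δ) (SRRing K Δ))).X t) :
    cechModSelfEquiv K Δ (t + 1)
        (((cechComplex K Δ (ModuleCat.of (SRRing K Δ) (SRRing K Δ))).d t (t + 1)).hom x) =
      cechD K Δ t (cechModSelfEquiv K Δ t x) := by
  rw [cechComplex_d]
  exact cechModSelfEquiv_cechModD K Δ t x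

theorem nonempty_cechComplex_homology_equiv_cechCohomology (i : ℕ) :
    Nonempty ((cechComplex K Δ (ModuleCat.of (SRRing K Δ) (SRRing K Δ))).homology i
      ≃ₗ[SRRing K Δ] CechCohomology K Δ i) := by
  let C := cechComplex K Δ (ModuleCat.of (SRRing K Δ) (SRRing K Δ))
  let e (t : ℕ) : C.X t ≃ₗ[SRRing K Δ] CechCochain K Δ t := cechModSelfEquiv K Δ t
  have he (t : ℕ) (x : C.X t) : e (t + 1) ((C.d t (t + 1)).hom x) = cechD K Δ t (e t x) :=
    cechModSelfEquiv_cechComplex_d K Δ t x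
  have hg (x : C.X i) : (C.d i (i + 1)).hom x = 0 ↔ cechD K Δ i (e i x) = 0 := by
    rw [← he]
    exact (e (i + 1)).map_eq_zero_iff.symm
  have hf : ∀ z, z ∈ cechBoundaries K Δ i ↔
      ∃ x, e i ((C.d ((ComplexShape.up ℕ).prev i) i).hom x) = z := by
    intro z
    cases i with
    | zero =>
      have h : C.d ((ComplexShape.up ℕ).prev 0) 0 = 0 := C.shape _ _ (by simp)
      rw [h]
      exact ⟨fun hz => ⟨0, ((e 0).map_zero).trans hz.symm⟩, fun ⟨_, hx⟩ =>
        (hx.symm.trans (e 0).map_zero)⟩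
    | succ i =>
      rw [CochainComplex.prev_nat_succ]
      constructor
      · rintro ⟨x, rfl⟩
        exact ⟨(e i).symm x, by rw [he, LinearEquiv.apply_symm_apply]⟩
      · rintro ⟨x, rfl⟩
        exact ⟨e i x, (he i x).symm⟩
  obtain ⟨e'⟩ := nonempty_homology_equiv (C.sc' ((ComplexShape.up ℕ).prev i) i (i + 1)) (e i)
    (cechD K Δ i) (cechBoundaries K Δ i) hg hf
  exact ⟨(ShortComplex.homologyMapIso (C.isoSc' _ i (i + 1) rfl (by simp))).toLinearEquiv.trans e'⟩

theorem nonempty_lc_equiv_cechCohomology (i : ℕ) :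
    Nonempty (LC K Δ i ≃ₗ[SRRing K Δ] CechCohomology K Δ i) := by
  obtain ⟨e⟩ := nonempty_localCohomology_equiv_cechComplex_homology K Δ i
    (ModuleCat.of (SRRing K Δ) (SRRing K Δ))
  obtain ⟨e'⟩ := nonempty_cechComplex_homology_equiv_cechCohomology K Δ i
  exact ⟨e.trans e'⟩

end CechCohomology

/-! ### Laurent monomials in the localizations of the Stanley-Reisner ring -/

section Monomials

variable (K : Type u) [Field K] {m n : ℕ} (Δ : SComplex (Fin m ⊕ Fin n))

theorem srMonomial_add (e f : Fin m ⊕ Fin n →₀ ℕ) :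
    srMonomial K Δ (e + f) = srMonomial K Δ e * srMonomial K Δ f := by
  rw [srMonomial, srMonomial, srMonomial, ← map_mul, MvPolynomial.monomial_mul, one_mul]

theorem srMonomial_eq_zero {e : Fin m ⊕ Fin n →₀ ℕ} (he : e.support ∉ Δ) :
    srMonomial K Δ e = 0 := by
  rw [srMonomial, Ideal.Quotient.eq_zero_iff_mem, MvPolynomial.monomial_eq, map_one, one_mul]
  refine Ideal.mem_of_dvd _ (Finset.prod_dvd_prod_of_dvd _ _ fun v hv => ?_)
    (Ideal.subset_span ⟨e.support, he, rfl⟩)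
  exact dvd_pow_self _ (Finsupp.mem_support_iff.1 hv)

/-- The exponent vector of `y_T`. -/
def yExponent (T : Finset (Fin n)) : Fin m ⊕ Fin n →₀ ℕ :=
  ∑ j ∈ T, Finsupp.single (Sum.inr j) 1

theorem yProd_eq_srMonomial (T : Finset (Fin n)) :
    yProd K Δ T = srMonomial K Δ (yExponent T) := by
  rw [yProd, srMonomial, yExponent, MvPolynomial.monomial_sum_one, map_prod]
  rfl

theorem coe_yExponent (T : Finset (Fin n)) (v : Fin m ⊕ Fin n) :
    ((yExponent T v : ℕ) : ℤ) = yDegree T v := by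
  classical
  rw [yExponent, Finsupp.finsetSum_apply]
  rcases v with k | j
  · simp [yDegree]
  · simp [yDegree, Finsupp.single_apply]

theorem pow_yProd_eq_srMonomial (T : Finset (Fin n)) (l : ℕ) :
    yProd K Δ T ^ l = srMonomial K Δ (l • yExponent T) := by
  rw [yProd_eq_srMonomial, srMonomial, srMonomial, ← map_pow, MvPolynomial.monomial_pow, one_pow]

variable {K Δ}

/-- The homomorphism from `K[Δ]` to a Laurent polynomial ring that kills the variables outside of
the face `U`. -/
def faceHom {U : Finset (Fin m ⊕ Fin n)} (hU : U ∈ Δ) :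
    SRRing K Δ →ₐ[K] AddMonoidAlgebra K (Fin m ⊕ Fin n → ℤ) :=
  Ideal.Quotient.liftₐ (srIdeal K Δ)
    (MvPolynomial.aeval fun v => if v ∈ U then AddMonoidAlgebra.single (Pi.single v 1) 1 else 0)
    (by
      change srIdeal K Δ ≤ RingHom.ker (MvPolynomial.aeval (R := K) _)
      refine Ideal.span_le.2 ?_
      rintro _ ⟨F, hF, rfl⟩
      obtain ⟨v, hvF, hvU⟩ : ∃ v ∈ F, v ∉ U :=
        Finset.not_subset.1 fun h => hF (Δ.lower h hU)
      change MvPolynomial.aeval (R := K) _ _ = 0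
      rw [map_prod]
      refine Finset.prod_eq_zero hvF ?_
      rw [MvPolynomial.aeval_X, if_neg hvU])

theorem faceHom_srMonomial {U : Finset (Fin m ⊕ Fin n)} (hU : U ∈ Δ) (e : Fin m ⊕ Fin n →₀ ℕ) :
    faceHom (K := K) hU (srMonomial K Δ e) =
      if e.support ⊆ U then AddMonoidAlgebra.single (fun v => (e v : ℤ)) 1 else 0 := by
  have h : faceHom (K := K) hU (srMonomial K Δ e) = ∏ v ∈ e.support,
      (if v ∈ U then AddMonoidAlgebra.single (Pi.single v (1 : ℤ)) (1 : K) else 0) ^ e v := by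
    change MvPolynomial.aeval (R := K) _ (MvPolynomial.monomial e 1) = _
    rw [MvPolynomial.aeval_monomial, map_one, one_mul]
    rfl
  rw [h]
  split_ifs with hs
  · have h' : (fun v => (e v : ℤ)) = ∑ v ∈ e.support, e v • Pi.single v (1 : ℤ) := by
      funext w
      rw [Finset.sum_apply]
      simp only [Pi.smul_apply, Pi.single_apply]
      simp +contextual [eq_comm]
    have h1 : ∀ v ∈ e.support,
        (if v ∈ U then AddMonoidAlgebra.single (Pi.single v 1 : Fin m ⊕ Fin n → ℤ) (1 : K)
          else 0) ^ e v =
          AddMonoidAlgebra.single (e v • (Pi.single v 1 : Fin m ⊕ Fin n → ℤ)) 1 := fun v hv => by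
      rw [if_pos (hs hv), AddMonoidAlgebra.single_pow, one_pow]
    rw [h', Finset.prod_congr rfl h1, AddMonoidAlgebra.prod_single, Finset.prod_const_one]
  · obtain ⟨v, hv, hvU⟩ := Finset.not_subset.1 hs
    refine Finset.prod_eq_zero hv ?_
    rw [if_neg hvU, zero_pow (Finsupp.mem_support_iff.1 hv)]

theorem faceHom_pow_yProd {U : Finset (Fin m ⊕ Fin n)} (hU : U ∈ Δ) {T : Finset (Fin n)}
    (hT : T.map Function.Embedding.inr ⊆ U) (l : ℕ) :
    faceHom (K := K) hU (yProd K Δ T ^ l) = AddMonoidAlgebra.single (l • yDegree T) 1 := by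
  rw [pow_yProd_eq_srMonomial, faceHom_srMonomial, if_pos]
  · congr 1
    funext v
    simp [coe_yExponent]
  · intro v hv
    have : yDegree T v ≠ 0 := by
      rw [← coe_yExponent]
      rw [Finsupp.mem_support_iff, Finsupp.smul_apply, smul_eq_mul] at hv
      exact_mod_cast right_ne_zero_of_mul hv
    rcases v with k | j
    · exact absurd rfl this
    · refine hT (Finset.mem_map_of_mem _ ?_)
      by_contra h
      exact this (if_neg h)

/-- The residue classes of the monomials span the Stanley-Reisner ring. -/
theorem srRing_induction {p : SRRing K Δ → Prop} (r : SRRing K Δ)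
    (add : ∀ r s, p r → p s → p (r + s))
    (smul_monomial : ∀ (k : K) e, p (k • srMonomial K Δ e)) : p r := by
  obtain ⟨f, rfl⟩ := Ideal.Quotient.mk_surjective r
  induction f using MvPolynomial.induction_on' with
  | monomial e k =>
    have := smul_monomial k e
    rwa [srMonomial, ← Ideal.Quotient.mkₐ_eq_mk K, ← map_smul, MvPolynomial.smul_monomial,
      smul_eq_mul, mul_one] at this
  | add f g hf hg =>
    rw [map_add]
    exact add _ _ hf hg

/-- The coefficient of `faceHom` at `d` depends only on which of the vertices with a positive
exponent in `d` belong to the face. -/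
theorem coeff_faceHom_eq {U U' : Finset (Fin m ⊕ Fin n)} (hU : U ∈ Δ) (hU' : U' ∈ Δ)
    {d : Fin m ⊕ Fin n → ℤ} (hd : ∀ v, 0 < d v → (v ∈ U ↔ v ∈ U')) (r : SRRing K Δ) :
    (faceHom hU r).coeff d = (faceHom hU' r).coeff d := by
  induction r using srRing_induction with
  | add r s hr hs =>
    rw [map_add, map_add, AddMonoidAlgebra.coeff_add, AddMonoidAlgebra.coeff_add,
      Finsupp.add_apply, Finsupp.add_apply, hr, hs]
  | smul_monomial k e =>
    simp only [map_smul, AddMonoidAlgebra.coeff_smul, Finsupp.smul_apply, faceHom_srMonomial]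
    by_cases h : (fun v => (e v : ℤ)) = d
    · have : e.support ⊆ U ↔ e.support ⊆ U' := by
        refine forall₂_congr fun v hv => hd v ?_
        rw [← h]
        exact Nat.cast_pos.2 <| Nat.pos_of_ne_zero (Finsupp.mem_support_iff.1 hv)
      simp only [this]
    · split_ifs <;> simp [h]

theorem coeff_faceHom_of_neg {U : Finset (Fin m ⊕ Fin n)} (hU : U ∈ Δ)
    {d : Fin m ⊕ Fin n → ℤ} {v : Fin m ⊕ Fin n} (hd : d v < 0) (r : SRRing K Δ) :
    (faceHom hU r).coeff d = 0 := by
  induction r using srRing_induction with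
  | add r s hr hs =>
    rw [map_add, AddMonoidAlgebra.coeff_add, Finsupp.add_apply, hr, hs, add_zero]
  | smul_monomial k e =>
    have h : (fun v => (e v : ℤ)) ≠ d := by
      rintro rfl
      exact absurd hd (by simp)
    simp only [map_smul, AddMonoidAlgebra.coeff_smul, Finsupp.smul_apply, faceHom_srMonomial]
    split_ifs <;> simp [h]

/-- The extension of `faceHom` to the localization at `y_T`, for `T ⊆ U`. -/
def locHom {U : Finset (Fin m ⊕ Fin n)} (hU : U ∈ Δ) {T : Finset (Fin n)}
    (hT : T.map Function.Embedding.inr ⊆ U) :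
    CechLoc K Δ T →+* AddMonoidAlgebra K (Fin m ⊕ Fin n → ℤ) :=
  IsLocalization.Away.lift (yProd K Δ T) (g := (faceHom (K := K) hU).toRingHom) (by
    have h := faceHom_pow_yProd (K := K) hU hT 1
    rw [pow_one] at h
    change IsUnit (faceHom hU (yProd K Δ T))
    rw [h]
    refine IsUnit.of_mul_eq_one (AddMonoidAlgebra.single (-(1 • yDegree T)) 1) ?_
    rw [AddMonoidAlgebra.single_mul_single, add_neg_cancel, one_mul]
    rfl)

theorem locHom_algebraMap {U : Finset (Fin m ⊕ Fin n)} (hU : U ∈ Δ) {T : Finset (Fin n)}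
    (hT : T.map Function.Embedding.inr ⊆ U) (r : SRRing K Δ) :
    locHom hU hT (algebraMap _ _ r) = faceHom hU r :=
  IsLocalization.Away.lift_eq _ _ _

/-- The coefficient of multidegree `c` of an element of the localization at `y_T`. -/
def locCoeff {U : Finset (Fin m ⊕ Fin n)} (hU : U ∈ Δ) {T : Finset (Fin n)}
    (hT : T.map Function.Embedding.inr ⊆ U) (c : Fin m ⊕ Fin n → ℤ) : CechLoc K Δ T →ₗ[K] K where
  toFun z := (locHom hU hT z).coeff c
  map_add' z w := by rw [map_add]; rfl
  map_smul' k z := by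
    have h : k • z = algebraMap (SRRing K Δ) _ (algebraMap K _ k) * z := by
      rw [← IsScalarTower.algebraMap_apply, Algebra.smul_def]
    rw [h, map_mul, locHom_algebraMap, AlgHom.commutes, ← Algebra.smul_def]
    rfl

/-- Coefficients of a fraction in terms of coefficients of its numerator. -/
theorem locCoeff_eq {U : Finset (Fin m ⊕ Fin n)} (hU : U ∈ Δ) {T : Finset (Fin n)}
    (hT : T.map Function.Embedding.inr ⊆ U) (c : Fin m ⊕ Fin n → ℤ) {z : CechLoc K Δ T} {l : ℕ}
    {r : SRRing K Δ} (h : algebraMap _ _ (yProd K Δ T ^ l) * z = algebraMap _ _ r) :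
    locCoeff hU hT c z = (faceHom hU r).coeff (c + l • yDegree T) := by
  rw [← locHom_algebraMap hU hT, ← h, map_mul, locHom_algebraMap, faceHom_pow_yProd hU hT,
    AddMonoidAlgebra.coeff_single_mul_apply, one_mul, add_comm c, neg_add_cancel_left]
  rfl

end Monomials

section Strand

variable {K : Type u} [Field K] {m n : ℕ} {Δ : SComplex (Fin m ⊕ Fin n)}

theorem exists_pow_mul_eq {T : Finset (Fin n)} (z : CechLoc K Δ T) :
    ∃ (l : ℕ) (r : SRRing K Δ), algebraMap _ _ (yProd K Δ T ^ l) * z = algebraMap _ _ r := by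
  obtain ⟨r, ⟨_, l, rfl⟩, h⟩ := IsLocalization.exists_mk'_eq (Submonoid.powers (yProd K Δ T)) z
  exact ⟨l, r, h ▸ IsLocalization.mk'_spec' (CechLoc K Δ T) r (⟨_, l, rfl⟩ : Submonoid.powers _)⟩

theorem isUnit_algebraMap_pow_yProd {T T' : Finset (Fin n)} (h : T ⊆ T') (l : ℕ) :
    IsUnit (algebraMap (SRRing K Δ) (CechLoc K Δ T') (yProd K Δ T ^ l)) := by
  rw [map_pow]
  exact (isUnit_yProd K Δ h).pow l

theorem pow_yProd_mul_mk (T : Finset (Fin n)) (r : SRRing K Δ) (l : ℕ) :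
    algebraMap _ _ (yProd K Δ T ^ l) * (Localization.mk r
        (⟨yProd K Δ T ^ l, ⟨l, rfl⟩⟩ : Submonoid.powers (yProd K Δ T)) : CechLoc K Δ T) =
      algebraMap _ _ r := by
  rw [Localization.mk_eq_mk']
  exact IsLocalization.mk'_spec' (CechLoc K Δ T) r (⟨_, l, rfl⟩ : Submonoid.powers _)

/-- The homogeneous component is spanned by the fractions with monomial numerator. -/
theorem locComponent_le {T : Finset (Fin n)} {c : Fin m ⊕ Fin n → ℤ}
    {N : Submodule K (CechLoc K Δ T)}
    (h : ∀ (z : CechLoc K Δ T) (l : ℕ) (e : Fin m ⊕ Fin n →₀ ℕ),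
      (∀ v, (e v : ℤ) = c v + l • yDegree T v) →
      algebraMap _ _ (yProd K Δ T ^ l) * z = algebraMap _ _ (srMonomial K Δ e) → z ∈ N) :
    locComponent K Δ T c ≤ N := by
  refine Submodule.span_le.2 ?_
  rintro _ ⟨l, d, r, hr, hd, rfl⟩
  let φ : SRRing K Δ →ₗ[K] CechLoc K Δ T :=
    { toFun r := Localization.mk r ⟨yProd K Δ T ^ l, ⟨l, rfl⟩⟩
      map_add' r s := by rw [Localization.add_mk_self]
      map_smul' k r := by rw [RingHom.id_apply, Localization.smul_mk] }
  have : srComponent K Δ d ≤ N.comap φ := by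
    refine Submodule.span_le.2 ?_
    rintro _ ⟨e, he, rfl⟩
    refine h _ l e (fun v => ?_) (pow_yProd_mul_mk _ _ _)
    rw [he, ← hd, Pi.sub_apply, Pi.smul_apply, sub_add_cancel]
  exact this hr

theorem mem_locComponent {T : Finset (Fin n)} {c : Fin m ⊕ Fin n → ℤ} {z : CechLoc K Δ T} {l : ℕ}
    {e : Fin m ⊕ Fin n →₀ ℕ} (he : ∀ v, (e v : ℤ) = c v + l • yDegree T v)
    (hz : algebraMap _ _ (yProd K Δ T ^ l) * z = algebraMap _ _ (srMonomial K Δ e)) :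
    z ∈ locComponent K Δ T c := by
  refine Submodule.subset_span ⟨l, fun v => e v, srMonomial K Δ e,
    Submodule.subset_span ⟨e, fun _ => rfl, rfl⟩, ?_, ?_⟩
  · funext v
    rw [Pi.sub_apply, he, Pi.smul_apply, add_sub_cancel_right]
  · refine (isUnit_algebraMap_pow_yProd (subset_refl T) l).mul_left_cancel ?_
    rw [hz, pow_yProd_mul_mk]

theorem cechNat_algebraMap {T T' : Finset (Fin n)} (h : T ⊆ T') (r : SRRing K Δ) :
    cechNat K Δ h (algebraMap _ _ r) = algebraMap _ _ r :=
  (cechNat K Δ h).commutes r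

theorem yExponent_add_sdiff {T T' : Finset (Fin n)} (h : T ⊆ T') :
    yExponent (m := m) T + yExponent (T' \ T) = yExponent T' := by
  rw [yExponent, yExponent, add_comm, Finset.sum_sdiff h, yExponent]

theorem yDegree_add_sdiff {T T' : Finset (Fin n)} (h : T ⊆ T') (v : Fin m ⊕ Fin n) :
    yDegree T v + yDegree (T' \ T) v = yDegree T' v := by
  rw [← coe_yExponent, ← coe_yExponent, ← coe_yExponent, ← yExponent_add_sdiff h,
    Finsupp.add_apply, Nat.cast_add]

theorem yProd_mul_sdiff {T T' : Finset (Fin n)} (h : T ⊆ T') :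
    yProd K Δ (T' \ T) * yProd K Δ T = yProd K Δ T' :=
  Finset.prod_sdiff h

theorem algebraMap_pow_yProd_mul {T T' : Finset (Fin n)} (h : T ⊆ T') (l : ℕ)
    (w : CechLoc K Δ T') :
    algebraMap _ _ (yProd K Δ T' ^ l) * w =
      algebraMap _ _ (yProd K Δ (T' \ T) ^ l) * (algebraMap _ _ (yProd K Δ T ^ l) * w) := by
  rw [← mul_assoc, ← map_mul, ← mul_pow, yProd_mul_sdiff h]

/-- The differential of the Čech complex is homogeneous. -/
theorem cechNat_mem_locComponent {T T' : Finset (Fin n)} (h : T ⊆ T') {c : Fin m ⊕ Fin n → ℤ}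
    {z : CechLoc K Δ T} (hz : z ∈ locComponent K Δ T c) :
    cechNat K Δ h z ∈ locComponent K Δ T' c := by
  have : locComponent K Δ T c ≤
      (locComponent K Δ T' c).comap ((cechNat K Δ h).toLinearMap.restrictScalars K) := by
    refine locComponent_le fun z l e he hz => ?_
    refine mem_locComponent (l := l) (e := e + l • yExponent (T' \ T)) (fun v => ?_) ?_
    · rw [Finsupp.add_apply, Nat.cast_add, he, Finsupp.smul_apply, smul_eq_mul, Nat.cast_mul,
        coe_yExponent, ← yDegree_add_sdiff h, smul_add, add_assoc]
      simp
    · change _ * cechNat K Δ h z = _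
      rw [add_comm e, srMonomial_add, ← pow_yProd_eq_srMonomial, map_mul,
        ← cechNat_algebraMap h (srMonomial _ _ _), ← hz, map_mul, cechNat_algebraMap,
        algebraMap_pow_yProd_mul h]
  exact this hz

variable {a : Fin m → ℤ} {b : Fin n → ℤ}

/-- The condition on `T` for the component of multidegree `(a, b)` of `K[Δ]_{y_T}` to be nonzero,
if `a` is nonnegative and `b` is nonpositive. -/
def IsStrandFace (Δ : SComplex (Fin m ⊕ Fin n)) (a : Fin m → ℤ) (b : Fin n → ℤ)
    (T : Finset (Fin n)) : Prop :=
  supp b ⊆ T ∧ (supp a).disjSum T ∈ Δ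

theorem mem_supp {k : ℕ} {a : Fin k → ℤ} {i : Fin k} : i ∈ supp a ↔ a i ≠ 0 := by
  simp [supp]

theorem map_inr_subset_disjSum (s : Finset (Fin m)) (T : Finset (Fin n)) :
    T.map Function.Embedding.inr ⊆ s.disjSum T := by
  intro v hv
  obtain ⟨j, hj, rfl⟩ := Finset.mem_map.1 hv
  exact Finset.inr_mem_disjSum.2 hj

theorem locComponent_eq_bot (hb : ∀ j, b j ≤ 0) {T : Finset (Fin n)}
    (hT : ¬ IsStrandFace Δ a b T) : locComponent K Δ T (Sum.elim a b) = ⊥ := by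
  refine le_bot_iff.1 (locComponent_le fun z l e he hz => ?_)
  -- An exponent `b j < 0` requires `y_j` in the denominator.
  have hbT : supp b ⊆ T := by
    intro j hj
    by_contra hjT
    have h1 := he (Sum.inr j)
    have h2 := mem_supp.1 hj
    have h3 := hb j
    simp only [Sum.elim_inr, yDegree, if_neg hjT] at h1
    simp at h1
    omega
  -- Multiplied by `y_T`, the numerator is supported on a set containing the support of `a` and `T`.
  have h0 : srMonomial K Δ (e + yExponent T) = 0 := by
    refine srMonomial_eq_zero K Δ fun h => hT ⟨hbT, Δ.lower ?_ h⟩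
    rintro (k | j) hv
    · have h1 := he (Sum.inl k)
      have h2 := mem_supp.1 (Finset.inl_mem_disjSum.1 hv)
      simp [yDegree] at h1
      simp only [Finsupp.mem_support_iff, Finsupp.add_apply]
      omega
    · have h1 := coe_yExponent T (Sum.inr j : Fin m ⊕ Fin n)
      simp only [yDegree, Sum.elim_inr, if_pos (Finset.inr_mem_disjSum.1 hv)] at h1
      simp only [Finsupp.mem_support_iff, Finsupp.add_apply]
      omega
  have h1 : yProd K Δ T ^ 1 * srMonomial K Δ e = 0 := by
    rw [pow_one, yProd_eq_srMonomial, mul_comm, ← srMonomial_add, h0]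
  rw [Submodule.mem_bot]
  refine (isUnit_algebraMap_pow_yProd (subset_refl T) 1).mul_left_cancel ?_
  refine (isUnit_algebraMap_pow_yProd (subset_refl T) l).mul_left_cancel ?_
  rw [mul_left_comm, hz, ← map_mul, h1, map_zero, mul_zero, mul_zero]

open Classical in
/-- The coefficient of multidegree `(a, b)` on `K[Δ]_{y_T}`, set to zero if the component of that
multidegree is zero. -/
def strandCoeff (K : Type u) [Field K] (Δ : SComplex (Fin m ⊕ Fin n)) (a : Fin m → ℤ)
    (b : Fin n → ℤ) (T : Finset (Fin n)) : CechLoc K Δ T →ₗ[K] K :=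
  if h : IsStrandFace Δ a b T then
    locCoeff h.2 (map_inr_subset_disjSum _ _) (Sum.elim a b) else 0

theorem strandCoeff_of_not {T : Finset (Fin n)} (h : ¬ IsStrandFace Δ a b T) :
    strandCoeff K Δ a b T = 0 := dif_neg h

theorem strandCoeff_eq {T : Finset (Fin n)} (h : IsStrandFace Δ a b T) {z : CechLoc K Δ T} {l : ℕ}
    {r : SRRing K Δ} (hz : algebraMap _ _ (yProd K Δ T ^ l) * z = algebraMap _ _ r) :
    strandCoeff K Δ a b T z = (faceHom h.2 r).coeff (Sum.elim a b + l • yDegree T) := by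
  rw [strandCoeff, dif_pos h]
  exact locCoeff_eq _ _ _ hz

/-- The coefficient functionals are compatible with the maps of the Čech complex. -/
theorem strandCoeff_cechNat (hb : ∀ j, b j ≤ 0) {T T' : Finset (Fin n)} (h : T ⊆ T')
    (hT' : IsStrandFace Δ a b T') (z : CechLoc K Δ T) :
    strandCoeff K Δ a b T' (cechNat K Δ h z) = strandCoeff K Δ a b T z := by
  obtain ⟨l, r, hz⟩ := exists_pow_mul_eq z
  have hz' : algebraMap _ _ (yProd K Δ T' ^ l) * cechNat K Δ h z =
      algebraMap _ _ (yProd K Δ (T' \ T) ^ l * r) := by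
    rw [map_mul, ← cechNat_algebraMap h r, ← hz, map_mul, cechNat_algebraMap,
      algebraMap_pow_yProd_mul h]
  have hdeg : -(l • yDegree (T' \ T)) + (Sum.elim a b + l • yDegree T') =
      Sum.elim a b + l • yDegree T := by
    funext v
    simp only [Pi.add_apply, Pi.neg_apply, Pi.smul_apply, ← yDegree_add_sdiff h, smul_add]
    ring
  rw [strandCoeff_eq hT' hz', map_mul, faceHom_pow_yProd hT'.2 ((Finset.map_subset_map.2
    Finset.sdiff_subset).trans (map_inr_subset_disjSum _ _)),
    AddMonoidAlgebra.coeff_single_mul_apply, one_mul, hdeg]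
  by_cases hT : IsStrandFace Δ a b T
  · rw [strandCoeff_eq hT hz]
    refine coeff_faceHom_eq _ _ ?_ r
    rintro (k | j) hv
    · simp
    · simp only [Finset.inr_mem_disjSum]
      refine ⟨fun _ => ?_, fun hj => h hj⟩
      by_contra hj
      have := hb j
      simp [yDegree, hj] at hv
      omega
  · rw [strandCoeff_of_not hT, LinearMap.zero_apply]
    have hbT : ¬ supp b ⊆ T := fun h' =>
      hT ⟨h', Δ.lower (Finset.disjSum_mono (subset_refl _) h) hT'.2⟩
    obtain ⟨j, hj, hjT⟩ := Finset.not_subset.1 hbT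
    refine coeff_faceHom_of_neg hT'.2 (v := Sum.inr j) ?_ r
    have := hb j
    have := mem_supp.1 hj
    simp [yDegree, hjT]
    omega

/-- The component of multidegree `(a, b)` of `K[Δ]_{y_T}` is at most one-dimensional; it is spanned
by the Laurent monomial of that multidegree. -/
theorem exists_strandMonomial (K : Type u) [Field K] (ha : ∀ k, 0 ≤ a k) {T : Finset (Fin n)}
    (hT : IsStrandFace Δ a b T) :
    ∃ z₀ ∈ locComponent K Δ T (Sum.elim a b), strandCoeff K Δ a b T z₀ = 1 ∧
      ∀ z ∈ locComponent K Δ T (Sum.elim a b), z = strandCoeff K Δ a b T z • z₀ := by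
  -- `y_T ^ l₀` is a large enough denominator for the Laurent monomial of multidegree `(a, b)`.
  let l₀ : ℕ := ∑ j, (b j).natAbs
  have hpos (v : Fin m ⊕ Fin n) : 0 ≤ Sum.elim a b v + l₀ • yDegree T v := by
    rcases v with k | j
    · simpa [yDegree] using ha k
    · by_cases hj : j ∈ T
      · have : (b j).natAbs ≤ l₀ :=
          Finset.single_le_sum (f := fun j => (b j).natAbs) (fun _ _ => Nat.zero_le _)
            (Finset.mem_univ j)
        simp [yDegree, hj]
        omega
      · have : b j = 0 := by
          by_contra h
          exact hj (hT.1 (mem_supp.2 h))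
        simp [yDegree, hj, this]
  let e₀ : Fin m ⊕ Fin n →₀ ℕ :=
    Finsupp.equivFunOnFinite.symm fun v => (Sum.elim a b v + l₀ • yDegree T v).toNat
  have he₀ (v) : (e₀ v : ℤ) = Sum.elim a b v + l₀ • yDegree T v := Int.toNat_of_nonneg (hpos v)
  have hval (z : CechLoc K Δ T) (l : ℕ) (e : Fin m ⊕ Fin n →₀ ℕ)
      (he : ∀ v, (e v : ℤ) = Sum.elim a b v + l • yDegree T v)
      (hz : algebraMap _ _ (yProd K Δ T ^ l) * z = algebraMap _ _ (srMonomial K Δ e)) :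
      strandCoeff K Δ a b T z = 1 := by
    rw [strandCoeff_eq hT hz, faceHom_srMonomial, if_pos]
    · rw [show (fun v => (e v : ℤ)) = Sum.elim a b + l • yDegree T from funext he]
      simp
    · rintro (k | j) hv
      · have := he (Sum.inl k)
        rw [Finsupp.mem_support_iff] at hv
        simp [yDegree] at this
        exact Finset.inl_mem_disjSum.2 (mem_supp.2 (by omega))
      · refine Finset.inr_mem_disjSum.2 ?_
        by_contra hj
        have := he (Sum.inr j)
        have h0 : b j = 0 := by
          by_contra h
          exact hj (hT.1 (mem_supp.2 h))
        rw [Finsupp.mem_support_iff] at hv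
        simp [yDegree, hj, h0] at this
        exact hv this
  let z₀ : CechLoc K Δ T := Localization.mk (srMonomial K Δ e₀) ⟨yProd K Δ T ^ l₀, ⟨l₀, rfl⟩⟩
  have hz₀ := pow_yProd_mul_mk T (srMonomial K Δ e₀) l₀
  refine ⟨z₀, mem_locComponent he₀ hz₀, hval z₀ l₀ e₀ he₀ hz₀, ?_⟩
  have : locComponent K Δ T (Sum.elim a b) ≤ LinearMap.ker
      (LinearMap.id - (strandCoeff K Δ a b T).smulRight z₀) := by
    refine locComponent_le fun z l e he hz => ?_
    rw [LinearMap.mem_ker, LinearMap.sub_apply, LinearMap.smulRight_apply, LinearMap.id_apply,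
      hval z l e he hz, one_smul, sub_eq_zero]
    refine (isUnit_algebraMap_pow_yProd (subset_refl T) l).mul_left_cancel ?_
    refine (isUnit_algebraMap_pow_yProd (subset_refl T) l₀).mul_left_cancel ?_
    rw [mul_left_comm _ _ z₀, hz, hz₀, ← map_mul, ← map_mul, pow_yProd_eq_srMonomial,
      pow_yProd_eq_srMonomial, ← srMonomial_add, ← srMonomial_add]
    congr 2
    refine Finsupp.ext fun v => Nat.cast_injective (R := ℤ) ?_
    rw [Finsupp.add_apply, Finsupp.add_apply, Nat.cast_add, Nat.cast_add, he, he₀,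
      Finsupp.smul_apply, Finsupp.smul_apply, smul_eq_mul, smul_eq_mul, Nat.cast_mul,
      Nat.cast_mul, coe_yExponent, nsmul_eq_mul, nsmul_eq_mul]
    ring
  intro z hz
  have := this hz
  rwa [LinearMap.mem_ker, LinearMap.sub_apply, LinearMap.smulRight_apply, LinearMap.id_apply,
    sub_eq_zero] at this

end Strand

/-! ### The homogeneous strands of the Čech complex -/

section StrandComplex

variable {K : Type u} [Field K] {m n : ℕ} {Δ : SComplex (Fin m ⊕ Fin n)} {a : Fin m → ℤ}
  {b : Fin n → ℤ}

/-- The complex `(lk (F ∪ G))_W` for the supports `F` of `b` and `G` of `a`. -/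
abbrev strandLink (Δ : SComplex (Fin m ⊕ Fin n)) (a : Fin m → ℤ) (b : Fin n → ℤ) :
    SComplex (Fin n) :=
  restrict (link Δ ((supp a).disjSum (supp b)))

/-- The faces of `strandLink` are the complements of the support of `b` in the sets `T` for which
the component of multidegree `(a, b)` of `K[Δ]_{y_T}` is nonzero. -/
theorem mem_strandLink_iff {S : Finset (Fin n)} :
    S ∈ strandLink Δ a b ↔ IsStrandFace Δ a b (supp b ∪ S) ∧ Disjoint (supp b) S := by
  have h1 : (supp a).disjSum (supp b) ∪ S.map Function.Embedding.inr =
      (supp a).disjSum (supp b ∪ S) := by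
    ext (k | j) <;> simp
  have h2 : (supp a).disjSum (supp b) ∩ S.map Function.Embedding.inr =
      (supp b ∩ S).map Function.Embedding.inr := by
    ext (k | j) <;> simp
  change _ ∪ _ ∈ Δ ∧ _ ∩ _ = ∅ ↔ _
  rw [h1, h2, Finset.map_eq_empty, Finset.disjoint_iff_inter_eq_empty, IsStrandFace]
  simp

theorem chain_hom_ext {V : Type*} [LinearOrder V] {Γ : SComplex V} {q : ℤ} {A : Type*}
    [AddCommGroup A] {φ ψ : Chain Γ q →ₗ[ℤ] A}
    (h : ∀ S, φ (Finsupp.single S 1) = ψ (Finsupp.single S 1)) : φ = ψ :=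
  Finsupp.lhom_ext' fun S => LinearMap.ext_ring (h S)

theorem lift_single_one {ι A : Type*} [AddCommGroup A] (f : ι → A) (S : ι) :
    Finsupp.lift A ℤ ι f (Finsupp.single S 1) = f S := by
  simp [Finsupp.lift_apply]

theorem boundary_single {V : Type*} [LinearOrder V] (Γ : SComplex V) {p q : ℤ} (hpq : p = q + 1)
    (S : Face Γ p) : boundary Γ hpq (Finsupp.single S 1) =
      ∑ v : {v // v ∈ S.1}, cechSign S.1 v.1 • Finsupp.single (S.erase Γ hpq v.1 v.2) (1 : ℤ) :=
  lift_single_one _ S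

/-- The sign relating the Čech complex to the cochain complex of the link: `-1` to the number of
pairs `f < s` with `f ∈ F` and `s ∈ S`, which is the sign of the permutation that sorts the elements
of `S` followed by those of `F`. -/
def shuffleSign {ι : Type*} [LinearOrder ι] (F S : Finset ι) : ℤ := ∏ s ∈ S, cechSign F s

theorem shuffleSign_mul_self {ι : Type*} [LinearOrder ι] (F S : Finset ι) :
    shuffleSign F S * shuffleSign F S = 1 := by
  rw [shuffleSign, ← Finset.prod_mul_distrib]
  exact Finset.prod_eq_one fun s _ => cechSign_mul_self F s

theorem cechSign_union {ι : Type*} [LinearOrder ι] {F S : Finset ι} (h : Disjoint F S) (j : ι) :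
    cechSign (F ∪ S) j = cechSign F j * cechSign S j := by
  rw [cechSign, Finset.filter_union, Finset.card_union_of_disjoint
    (Finset.disjoint_filter_filter h), pow_add, cechSign, cechSign]

theorem shuffleSign_mul_cechSign {ι : Type*} [LinearOrder ι] {F S : Finset ι} (h : Disjoint F S)
    {j : ι} (hj : j ∈ S) :
    shuffleSign F S * cechSign (F ∪ S) j = cechSign S j * shuffleSign F (S.erase j) := by
  rw [cechSign_union h, shuffleSign, ← Finset.mul_prod_erase S _ hj, ← shuffleSign]
  linear_combination cechSign S j * shuffleSign F (S.erase j) * cechSign_mul_self F j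

theorem card_supp_union {q : ℤ} {t : ℕ} (h : (t : ℤ) = q + 1 + (supp b).card)
    (S : Face (strandLink Δ a b) q) : (supp b ∪ S.1).card = t := by
  have := S.2.2
  rw [Finset.card_union_of_disjoint (mem_strandLink_iff.1 S.2.1).2]
  omega

variable (K Δ a b) in
/-- The map from the Čech complex to the cochain complex of the link that extracts the
coefficients of multidegree `(a, b)`. -/
def strandMap {q : ℤ} {t : ℕ} (h : (t : ℤ) = q + 1 + (supp b).card) :
    CechCochain K Δ t →ₗ[K] (Chain (strandLink Δ a b) q →ₗ[ℤ] K) where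
  toFun x := Finsupp.lift K ℤ (Face (strandLink Δ a b) q) fun S =>
    shuffleSign (supp b) S.1 •
      strandCoeff K Δ a b (supp b ∪ S.1) (x ⟨supp b ∪ S.1, card_supp_union h S⟩)
  map_add' x y := by
    refine chain_hom_ext fun S => ?_
    simp
  map_smul' k x := by
    refine chain_hom_ext fun S => ?_
    simp
    ring

theorem strandMap_single {q : ℤ} {t : ℕ} (h : (t : ℤ) = q + 1 + (supp b).card)
    (x : CechCochain K Δ t) (S : Face (strandLink Δ a b) q) :
    strandMap K Δ a b h x (Finsupp.single S 1) = shuffleSign (supp b) S.1 •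
      strandCoeff K Δ a b (supp b ∪ S.1) (x ⟨supp b ∪ S.1, card_supp_union h S⟩) :=
  lift_single_one _ S

/-- `strandMap` commutes with the differentials: in the Čech differential at `F ∪ S`, only the terms
deleting an element of `S` contribute, and the signs differ by those in `shuffleSign`. -/
theorem strandMap_cechD (hb : ∀ j, b j ≤ 0) {p q : ℤ} (hpq : p = q + 1) {t : ℕ}
    (h : (t : ℤ) = q + 1 + (supp b).card) (h' : ((t + 1 : ℕ) : ℤ) = p + 1 + (supp b).card)
    (x : CechCochain K Δ t) :
    strandMap K Δ a b h' (cechD K Δ t x) =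
      coboundary (strandLink Δ a b) K hpq (strandMap K Δ a b h x) := by
  classical
  refine chain_hom_ext fun S => ?_
  obtain ⟨hS, hd⟩ := mem_strandLink_iff.1 S.2.1
  -- The coefficient of the component of `x` at `U`, with no proof about the size of `U`.
  let g (U : Finset (Fin n)) : K :=
    if hU : U.card = t then strandCoeff K Δ a b U (x ⟨U, hU⟩) else 0
  have hg (U : Finset (Fin n)) (hU : U.card = t) : strandCoeff K Δ a b U (x ⟨U, hU⟩) = g U := by
    simp only [g, dif_pos hU]
  have h1 : strandMap K Δ a b h' (cechD K Δ t x) (Finsupp.single S 1) =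
      ∑ j ∈ supp b ∪ S.1, (shuffleSign (supp b) S.1 * cechSign (supp b ∪ S.1) j) •
        g ((supp b ∪ S.1).erase j) := by
    rw [strandMap_single, cechD_eq_cubeD, cubeD_apply, map_sum, Finset.smul_sum]
    refine Eq.trans (Finset.sum_congr rfl fun j _ => ?_) (Finset.sum_coe_sort (supp b ∪ S.1)
      fun j => (shuffleSign (supp b) S.1 * cechSign (supp b ∪ S.1) j) •
        g ((supp b ∪ S.1).erase j))
    rw [map_zsmul, smul_smul]
    exact congrArg _ ((strandCoeff_cechNat hb (Finset.erase_subset _ _) hS _).trans (hg _ _))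
  have h2 : coboundary (strandLink Δ a b) K hpq (strandMap K Δ a b h x) (Finsupp.single S 1) =
      ∑ j ∈ S.1, (cechSign S.1 j * shuffleSign (supp b) (S.1.erase j)) •
        g (supp b ∪ S.1.erase j) := by
    change strandMap K Δ a b h x (boundary _ hpq _) = _
    rw [boundary_single, map_sum]
    refine Eq.trans (Finset.sum_congr rfl fun j _ => ?_) (Finset.sum_coe_sort S.1
      fun j => (cechSign S.1 j * shuffleSign (supp b) (S.1.erase j)) • g (supp b ∪ S.1.erase j))
    rw [map_zsmul, strandMap_single, smul_smul]
    exact congrArg _ (hg _ _)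
  rw [h1, h2, Finset.sum_union hd, Finset.sum_eq_zero, zero_add]
  · refine Finset.sum_congr rfl fun j hj => ?_
    rw [shuffleSign_mul_cechSign hd hj, Finset.erase_union_distrib,
      Finset.erase_eq_of_notMem (Finset.disjoint_right.1 hd hj)]
  · -- deleting an element of the support of `b` leaves the multidegree `(a, b)`
    intro j hj
    have : g ((supp b ∪ S.1).erase j) = 0 := by
      by_cases hU : ((supp b ∪ S.1).erase j).card = t
      · rw [← hg _ hU, strandCoeff_of_not, LinearMap.zero_apply]
        exact fun h => absurd (h.1 hj) (Finset.notMem_erase j _)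
      · exact dif_neg hU
    rw [this, smul_zero]

theorem mem_cechComponent_iff {c : Fin m ⊕ Fin n → ℤ} {t : ℕ} {x : CechCochain K Δ t} :
    x ∈ cechComponent K Δ t c ↔ ∀ T, x T ∈ locComponent K Δ T.1 c :=
  ⟨fun h T => h T (Set.mem_univ T), fun h T _ => h T⟩

theorem cechD_mem_cechComponent {c : Fin m ⊕ Fin n → ℤ} {t : ℕ} {x : CechCochain K Δ t}
    (hx : x ∈ cechComponent K Δ t c) : cechD K Δ t x ∈ cechComponent K Δ (t + 1) c := by
  rw [mem_cechComponent_iff] at hx ⊢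
  intro T
  rw [cechD_eq_cubeD, cubeD_apply]
  refine Submodule.sum_mem _ fun j _ => ?_
  rw [← Int.cast_smul_eq_zsmul K]
  refine Submodule.smul_mem _ _ ?_
  exact cechNat_mem_locComponent (Finset.erase_subset j.1 T.1) (hx ⟨T.1.erase j.1, _⟩)

/-- `strandMap` is injective on the homogeneous cochains. -/
theorem eq_zero_of_strandMap_eq_zero (ha : ∀ k, 0 ≤ a k) (hb : ∀ j, b j ≤ 0) {q : ℤ} {t : ℕ}
    (h : (t : ℤ) = q + 1 + (supp b).card) {x : CechCochain K Δ t}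
    (hx : x ∈ cechComponent K Δ t (Sum.elim a b)) (h0 : strandMap K Δ a b h x = 0) : x = 0 := by
  funext T
  have hxT := mem_cechComponent_iff.1 hx T
  by_cases hT : IsStrandFace Δ a b T.1
  · obtain ⟨z₀, -, -, hz⟩ := exists_strandMonomial K ha hT
    have hU : supp b ∪ T.1 \ supp b = T.1 := Finset.union_sdiff_of_subset hT.1
    let S : Face (strandLink Δ a b) q := ⟨T.1 \ supp b,
      mem_strandLink_iff.2 ⟨by rwa [hU], Finset.disjoint_sdiff⟩, by
        have h1 := Finset.card_sdiff_add_card_eq_card hT.1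
        have h2 := T.2
        omega⟩
    have h1 := LinearMap.congr_fun h0 (Finsupp.single S 1)
    rw [strandMap_single, LinearMap.zero_apply] at h1
    have h2 := congrArg (shuffleSign (supp b) S.1 • ·) h1
    simp only [smul_smul, shuffleSign_mul_self, one_smul, smul_zero] at h2
    have key (U : {U : Finset (Fin n) // U.card = t}) (hU : U = T)
        (h : strandCoeff K Δ a b U.1 (x U) = 0) : strandCoeff K Δ a b T.1 (x T) = 0 := by
      subst hU
      exact h
    rw [hz _ hxT, key ⟨_, _⟩ (Subtype.ext hU) h2, zero_smul]
    rfl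
  · rw [locComponent_eq_bot hb hT] at hxT
    exact hxT

/-- `strandMap` maps the homogeneous cochains onto the cochains of the link. -/
theorem exists_strandMap_eq (ha : ∀ k, 0 ≤ a k) {q : ℤ} {t : ℕ}
    (h : (t : ℤ) = q + 1 + (supp b).card) (φ : Chain (strandLink Δ a b) q →ₗ[ℤ] K) :
    ∃ x ∈ cechComponent K Δ t (Sum.elim a b), strandMap K Δ a b h x = φ := by
  have hex (T : {T : Finset (Fin n) // T.card = t}) :
      ∃ z ∈ locComponent K Δ T.1 (Sum.elim a b), ∀ S : Face (strandLink Δ a b) q,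
        supp b ∪ S.1 = T.1 → shuffleSign (supp b) S.1 • strandCoeff K Δ a b T.1 z =
          φ (Finsupp.single S 1) := by
    by_cases hT : ∃ S : Face (strandLink Δ a b) q, supp b ∪ S.1 = T.1
    · obtain ⟨S, hS⟩ := hT
      have hS' := mem_strandLink_iff.1 S.2.1
      obtain ⟨z₀, hz₀, h1, -⟩ := exists_strandMonomial (T := T.1) K ha (hS ▸ hS'.1)
      refine ⟨(shuffleSign (supp b) S.1 • φ (Finsupp.single S 1)) • z₀,
        Submodule.smul_mem _ _ hz₀, fun S' h' => ?_⟩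
      obtain rfl : S' = S := by
        refine Subtype.ext ?_
        rw [← Finset.union_sdiff_cancel_left hS'.2, hS, ← h',
          Finset.union_sdiff_cancel_left (mem_strandLink_iff.1 S'.2.1).2]
      rw [map_smul, h1, smul_eq_mul, mul_one, smul_smul, shuffleSign_mul_self, one_smul]
    · exact ⟨0, Submodule.zero_mem _, fun S hS => absurd ⟨S, hS⟩ hT⟩
  choose x hx hx' using hex
  refine ⟨x, mem_cechComponent_iff.2 hx, chain_hom_ext fun S => ?_⟩
  rw [strandMap_single]
  exact hx' ⟨_, _⟩ S rfl

/-- The coboundaries among the homogeneous cochains are the coboundaries of homogeneous cochains. -/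
theorem mem_cechBoundaries_iff (ha : ∀ k, 0 ≤ a k) (hb : ∀ j, b j ≤ 0) {q : ℤ} {t : ℕ}
    (h : (t : ℤ) = q + 1 + (supp b).card) {x : CechCochain K Δ t}
    (hx : x ∈ cechComponent K Δ t (Sum.elim a b)) :
    x ∈ cechBoundaries K Δ t ↔ strandMap K Δ a b h x ∈
      LinearMap.range (coboundary (strandLink Δ a b) K (p := q) (q := q - 1) (by ring)) := by
  cases t with
  | zero =>
    change x ∈ (⊥ : Submodule _ _) ↔ _
    rw [Submodule.mem_bot]
    refine ⟨fun h0 => ?_, ?_⟩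
    · rw [h0, map_zero]
      exact Submodule.zero_mem _
    · rintro ⟨φ, hφ⟩
      -- there are no faces of dimension `q - 1 = -|F| - 2`
      have : φ = 0 := chain_hom_ext fun S => absurd S.2.2 (by omega)
      rw [this, map_zero] at hφ
      exact eq_zero_of_strandMap_eq_zero ha hb h hx hφ.symm
  | succ t =>
    have h' : (t : ℤ) = q - 1 + 1 + (supp b).card := by
      push_cast at h
      omega
    constructor
    · rintro ⟨w, rfl⟩
      exact ⟨strandMap K Δ a b h' w, (strandMap_cechD hb _ h' h w).symm⟩
    · rintro ⟨φ, hφ⟩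
      obtain ⟨w, hw, rfl⟩ := exists_strandMap_eq ha h' φ
      refine ⟨w, (sub_eq_zero.1 (eq_zero_of_strandMap_eq_zero ha hb h
        (Submodule.sub_mem _ hx (cechD_mem_cechComponent hw)) ?_)).symm⟩
      rw [map_sub, strandMap_cechD hb (by ring) h' h w, hφ, sub_self]

theorem cechD_eq_zero_iff (ha : ∀ k, 0 ≤ a k) (hb : ∀ j, b j ≤ 0) {q : ℤ} {t : ℕ}
    (h : (t : ℤ) = q + 1 + (supp b).card) {x : CechCochain K Δ t}
    (hx : x ∈ cechComponent K Δ t (Sum.elim a b)) :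
    cechD K Δ t x = 0 ↔
      coboundary (strandLink Δ a b) K (rfl : q + 1 = q + 1) (strandMap K Δ a b h x) = 0 := by
  have h' : ((t + 1 : ℕ) : ℤ) = q + 1 + 1 + (supp b).card := by
    push_cast
    omega
  rw [← strandMap_cechD hb rfl h h']
  refine ⟨fun h0 => by rw [h0, map_zero], fun h0 => ?_⟩
  exact eq_zero_of_strandMap_eq_zero ha hb h' (cechD_mem_cechComponent hx) h0

/-- Two surjections with the same kernel have isomorphic targets. -/
theorem nonempty_map_equiv {A B N : Type*} [AddCommGroup A] [Module K A] [AddCommGroup B]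
    [Module K B] [AddCommGroup N] [Module K N] (π : A →ₗ[K] B) (Z : Submodule K A) (g : Z →ₗ[K] N)
    (hg : Function.Surjective g) (h : ∀ z : Z, π z = 0 ↔ g z = 0) :
    Nonempty (Z.map π ≃ₗ[K] N) := by
  have hfg : LinearMap.ker (π.submoduleMap Z) = LinearMap.ker g := by
    ext z
    rw [LinearMap.mem_ker, LinearMap.mem_ker, ← h, ← Submodule.coe_eq_zero]
    rfl
  exact ⟨((π.submoduleMap Z).quotKerEquivOfSurjective (π.submoduleMap_surjective Z)).symm.trans
    ((Submodule.quotEquivOfEq _ _ hfg).trans (g.quotKerEquivOfSurjective hg))⟩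

/-- The component of multidegree `(a, b)` of the Čech cohomology and the reduced cohomology of the
link are quotients of the space of homogeneous cocycles by the same subspace. -/
theorem nonempty_cechCohomologyComponent_equiv (ha : ∀ k, 0 ≤ a k) (hb : ∀ j, b j ≤ 0) {q : ℤ}
    {t : ℕ} (h : (t : ℤ) = q + 1 + (supp b).card) :
    Nonempty (cechCohomologyComponent K Δ t (Sum.elim a b) ≃ₗ[K]
      ReducedCohomology (strandLink Δ a b) K q) := by
  let Z : Submodule K (LinearMap.ker (cechD K Δ t)) :=
    (cechComponent K Δ t (Sum.elim a b)).comap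
      ((LinearMap.ker (cechD K Δ t)).subtype.restrictScalars K)
  let ψ : Z →ₗ[K] LinearMap.ker (coboundary (strandLink Δ a b) K (rfl : q + 1 = q + 1)) :=
    LinearMap.codRestrict _ (strandMap K Δ a b h ∘ₗ
      (LinearMap.ker (cechD K Δ t)).subtype.restrictScalars K ∘ₗ Z.subtype)
      fun z => (cechD_eq_zero_iff ha hb h z.2).1 z.1.2
  let g : Z →ₗ[K] ReducedCohomology (strandLink Δ a b) K q := Submodule.mkQ _ ∘ₗ ψ
  refine nonempty_map_equiv _ Z g ?_ fun z => ?_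
  · refine (Submodule.mkQ_surjective _).comp ?_
    rintro ⟨φ, hφ⟩
    obtain ⟨x, hx, rfl⟩ := exists_strandMap_eq ha h φ
    exact ⟨⟨⟨x, (cechD_eq_zero_iff ha hb h hx).2 hφ⟩, hx⟩, rfl⟩
  · have h1 : g z = 0 ↔ strandMap K Δ a b h z.1.1 ∈ LinearMap.range
        (coboundary (strandLink Δ a b) K (p := q) (q := q - 1) (by ring)) :=
      Submodule.Quotient.mk_eq_zero _
    refine Iff.trans ?_ ((mem_cechBoundaries_iff ha hb h z.2).trans h1.symm)
    exact Submodule.Quotient.mk_eq_zero _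

end StrandComplex

end MonomialLocalCohomology

end

theorem mainTheorem12 {K : Type u} [Field K] {m n : ℕ}
    (Δ : MonomialLocalCohomology.SComplex (Fin m ⊕ Fin n)) (i : ℕ) :
    Nonempty (MonomialLocalCohomology.LC K Δ i ≃ₗ[MonomialLocalCohomology.SRRing K Δ]
      MonomialLocalCohomology.CechCohomology K Δ i) ∧
    ∀ (e : MonomialLocalCohomology.LC K Δ i ≃ₗ[MonomialLocalCohomology.SRRing K Δ]
        MonomialLocalCohomology.CechCohomology K Δ i)
      (a : Fin m → ℤ) (b : Fin n → ℤ), (∀ k, 0 ≤ a k) → (∀ j, b j ≤ 0) →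
      Nonempty (MonomialLocalCohomology.lcComponent K Δ i e (Sum.elim a b) ≃ₗ[K]
        MonomialLocalCohomology.ReducedCohomology
          (MonomialLocalCohomology.restrict (MonomialLocalCohomology.link Δ
            ((MonomialLocalCohomology.supp a).disjSum (MonomialLocalCohomology.supp b))))
          K ((i : ℤ) - ((MonomialLocalCohomology.supp b).card : ℤ) - 1)) := by
  refine ⟨MonomialLocalCohomology.nonempty_lc_equiv_cechCohomology K Δ i, fun e a b ha hb => ?_⟩
  obtain ⟨f⟩ := MonomialLocalCohomology.nonempty_cechCohomologyComponent_equiv (K := K) (Δ := Δ)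
    ha hb (q := (i : ℤ) - (MonomialLocalCohomology.supp b).card - 1) (t := i) (by ring)
  exact ⟨((e.restrictScalars K).ofSubmodule' _).trans f⟩
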